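/- Operator spaces are complex, complete, and given by matrix norms $\|\cdot\|_n$ on $M_n(V)$, $n\in\mathbb N$, satisfying Ruan's axioms; for a linear map $\varphi$ write $\varphi_n([v_{ij}])=[\varphi(v_{ij})]$, let $CB(V,W)$ be the completely bounded maps $V\to W$ with norm $\|\varphi\|_{cb}=\sup\{\|\varphi_n(x)\|_n : n\in\mathbb N,\ x\in M_n(V),\ \|x\|_n\le 1\}$, and let $V\check\otimes B(H)$ be the completed minimal operator space tensor product. An operator space $V$ has the strong operator approximation property if the identity map of $V$ is a limit of a net of finite rank maps $\varphi_\nu\in CB(V,V)$ in the strongly stable point-norm topology, that is, $(\varphi_\nu\otimes\mathrm{id})(a)\to a$ in norm for every Hilbert space $H$ and every $a\in V\check\otimes B(H)$. A family $K=(K_n)_n$ of sets $K_n\subseteq M_n(V)$ is completely compact if each $K_n$ is closed, $\sup\{\|x\|_n : n\in\mathbb N,\ x\in K_n\}<\infty$, and for every $\varepsilon>0$ there is a finite-dimensional subspace $V_\varepsilon\subseteq V$ such that for all $n$ and all $x\in K_n$ there is $v\in M_n(V_\varepsilon)$ with $\|x-v\|_n<\varepsilon$. A map $\varphi\in CB(W,V)$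 is completely compact if the family of closures $\overline{\varphi_n(\{x\in M_n(W):\|x\|_n\le 1\})}$, $n\in\mathbb N$, is completely compact. **Theorem.** An operator space $V$ has the strong operator approximation property if and only if, for every operator space $W$, every completely compact map $\varphi\in CB(W,V)$ can be approximated completely uniformly by finite rank maps, i.e. for every $\varepsilon>0$ there is a finite rank map $\psi\in CB(W,V)$ with $\|\varphi-\psi\|_{cb}<\varepsilon$. -/

import Mathlib

open scoped TensorProduct Matrix Matrix.Norms.L2Operator

universe u v w

noncomputable section

/-- The two-sided scalar product `α v β`, for `α ∈ M_{n,m}`, `v ∈ M_m(V)` and `β ∈ M_{m,n}`. -/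
def scalarConj {V : Type u} [AddCommGroup V] [Module ℂ V] {n m : ℕ}
    (α : Matrix (Fin n) (Fin m) ℂ) (v : Matrix (Fin m) (Fin m) V)
    (β : Matrix (Fin m) (Fin n) ℂ) : Matrix (Fin n) (Fin n) V :=
  Matrix.of fun i j => ∑ k, ∑ l, (α i k * β l j) • v k l

/-- The direct sum `v ⊕ w ∈ M_{n+m}(V)` of `v ∈ M_n(V)` and `w ∈ M_m(V)`. -/
def matDirectSum {V : Type u} [AddCommGroup V] {n m : ℕ}
    (v : Matrix (Fin n) (Fin n) V) (w : Matrix (Fin m) (Fin m) V) :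
    Matrix (Fin (n + m)) (Fin (n + m)) V :=
  Matrix.reindex finSumFinEquiv finSumFinEquiv (Matrix.fromBlocks v 0 0 w)

/-- A matricial norm on `V` satisfying Ruan's axioms.  Together with `CompleteSpace V` this is an
(abstract) operator space.  Scalar matrices carry their operator norm between Euclidean spaces.
Each `matNorm n` is automatically a norm, see `norm_entry_le_matNorm`. -/
class OperatorSpace (V : Type u) [NormedAddCommGroup V] [NormedSpace ℂ V] where
  matNorm : ∀ n : ℕ, Seminorm ℂ (Matrix (Fin n) (Fin n) V)
  matNorm_one : ∀ x : V, matNorm 1 (Matrix.of fun _ _ => x) = ‖x‖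
  matNorm_directSum : ∀ {n m : ℕ} (v : Matrix (Fin n) (Fin n) V) (w : Matrix (Fin m) (Fin m) V),
    matNorm (n + m) (matDirectSum v w) = max (matNorm n v) (matNorm m w)
  matNorm_scalarConj_le : ∀ {n m : ℕ} (α : Matrix (Fin n) (Fin m) ℂ)
    (v : Matrix (Fin m) (Fin m) V) (β : Matrix (Fin m) (Fin n) ℂ),
    matNorm n (scalarConj α v β) ≤ ‖α‖ * matNorm m v * ‖β‖

open OperatorSpace (matNorm)

section Basic

variable {V : Type u} [NormedAddCommGroup V] [NormedSpace ℂ V] [OperatorSpace V]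

theorem norm_entry_le_matNorm {n : ℕ} (v : Matrix (Fin n) (Fin n) V) (i j : Fin n) :
    ‖v i j‖ ≤ matNorm n v := by
  let E : Fin n → Matrix (Fin n) (Fin 1) ℂ := fun a => Matrix.of fun k _ => if k = a then 1 else 0
  have hE : ∀ a, ‖E a‖ = 1 := fun a => by
    have h := Matrix.l2_opNorm_conjTranspose_mul_self (E a)
    have h1 : (E a)ᴴ * E a = 1 := by
      ext p q
      simp [E, Matrix.mul_apply, Matrix.one_apply, Subsingleton.elim p q]
    rw [h1, CStarRing.norm_one] at h
    nlinarith [norm_nonneg (E a)]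
  have h := OperatorSpace.matNorm_scalarConj_le (E i)ᴴ v (E j)
  have e : scalarConj (E i)ᴴ v (E j) = Matrix.of fun _ _ => v i j := by
    ext p q
    have : ∀ k l, ((E i)ᴴ p k * E j l q) • v k l
        = if l = j then (if k = i then v k l else 0) else 0 := fun k l => by
      by_cases hl : l = j <;> by_cases hk : k = i <;> simp [E, hl, hk]
    simp only [scalarConj, Matrix.of_apply, this]
    simp
  rwa [e, OperatorSpace.matNorm_one, Matrix.l2_opNorm_conjTranspose, hE, hE, one_mul,
    mul_one] at h

/-- `‖diag(x, …, x)‖ ≤ ‖x‖`. -/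
theorem matNorm_diagonal_le (x : V) (n : ℕ) :
    matNorm n (Matrix.diagonal fun _ => x) ≤ ‖x‖ := by
  induction n with
  | zero =>
    have : (Matrix.diagonal fun _ => x : Matrix (Fin 0) (Fin 0) V) = 0 := by ext i; exact i.elim0
    rw [this, map_zero]; exact norm_nonneg x
  | succ n ih =>
    have e : (Matrix.diagonal fun _ => x : Matrix (Fin (n + 1)) (Fin (n + 1)) V)
        = matDirectSum (Matrix.diagonal fun _ : Fin n => x)
            (Matrix.of fun (_ _ : Fin 1) => x) := by
      have h1 : (Matrix.of fun (_ _ : Fin 1) => x) = Matrix.diagonal fun _ : Fin 1 => x := by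
        ext i j; simp [Matrix.diagonal, Subsingleton.elim i j]
      rw [matDirectSum, h1, Matrix.fromBlocks_diagonal]
      ext i j
      simp only [Matrix.reindex_apply, Matrix.submatrix_apply, Matrix.diagonal_apply]
      rcases hi : finSumFinEquiv.symm i with a | a <;> simp [← hi]
    rw [e, OperatorSpace.matNorm_directSum, OperatorSpace.matNorm_one]
    exact max_le ih le_rfl

/-- `‖α ⊗ x‖ ≤ ‖α‖ ‖x‖` in `M_n(V)`. -/
theorem matNorm_smul_le {n : ℕ} (α : Matrix (Fin n) (Fin n) ℂ) (x : V) :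
    matNorm n (Matrix.of fun i j => α i j • x) ≤ ‖α‖ * ‖x‖ := by
  rcases n with _ | n
  · have : (Matrix.of fun i j => α i j • x : Matrix (Fin 0) (Fin 0) V) = 0 := by
      ext i; exact i.elim0
    rw [this, map_zero]; positivity
  have h := OperatorSpace.matNorm_scalarConj_le α (Matrix.diagonal fun _ => x) 1
  have e : scalarConj α (Matrix.diagonal fun _ => x) 1 = Matrix.of fun i j => α i j • x := by
    ext i j
    simp [scalarConj, Matrix.diagonal_apply, Matrix.one_apply]
  rw [e, CStarRing.norm_one, mul_one] at h
  exact h.trans (by gcongr; exact matNorm_diagonal_le x _)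

end Basic

section BoundedOperators

variable (H : Type u) [NormedAddCommGroup H] [InnerProductSpace ℂ H]

/-- The identification of `M_n(B(H))` with `B(Hⁿ)`, where `Hⁿ` is the Hilbert space direct sum:
`(b x)_i = ∑_j b_{ij} x_j`. -/
def matToOp (n : ℕ) : Matrix (Fin n) (Fin n) (H →L[ℂ] H) →ₗ[ℂ]
    (PiLp 2 (fun _ : Fin n => H) →L[ℂ] PiLp 2 (fun _ : Fin n => H)) where
  toFun b := (PiLp.continuousLinearEquiv 2 ℂ (fun _ : Fin n => H)).symm.toContinuousLinearMap ∘L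
    ContinuousLinearMap.pi fun i => ∑ j, b i j ∘L PiLp.proj 2 (fun _ : Fin n => H) j
  map_add' b c := by
    ext x i
    simp [Finset.sum_add_distrib]
  map_smul' r b := by
    ext x i
    simp [Finset.smul_sum]

variable {H}

@[simp] theorem matToOp_apply {n : ℕ} (b : Matrix (Fin n) (Fin n) (H →L[ℂ] H))
    (x : PiLp 2 (fun _ : Fin n => H)) (i : Fin n) :
    matToOp H n b x i = ∑ j, b i j (x j) := by
  simp [matToOp]

/-- A scalar matrix acts on Hilbert space vectors with norm at most its operator norm. -/
theorem scalar_action_bound {n m : ℕ} (α : Matrix (Fin n) (Fin m) ℂ) (x : Fin m → H) :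
    ∑ i, ‖∑ k, α i k • x k‖ ^ 2 ≤ ‖α‖ ^ 2 * ∑ k, ‖x k‖ ^ 2 := by
  let S : Submodule ℂ H := Submodule.span ℂ (Set.range x)
  have : FiniteDimensional ℂ S := FiniteDimensional.span_of_finite ℂ (Set.finite_range x)
  let e := stdOrthonormalBasis ℂ S
  let y : Fin m → S := fun k => ⟨x k, Submodule.subset_span ⟨k, rfl⟩⟩
  have hn : ∀ z : S, ‖z‖ ^ 2 = ∑ t, ‖e.repr z t‖ ^ 2 := fun z => by
    rw [← e.repr.norm_map z, EuclideanSpace.norm_sq_eq]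
  have h1 : ∀ i, ‖∑ k, α i k • x k‖ ^ 2 = ∑ t, ‖∑ k, α i k * e.repr (y k) t‖ ^ 2 := fun i => by
    have hs : ((∑ k, α i k • y k : S) : H) = ∑ k, α i k • x k := by
      simp [y]
    have : ‖∑ k, α i k • x k‖ = ‖∑ k, α i k • y k‖ := by
      rw [← hs]; rfl
    rw [this, hn]; simp
  have h2 : ∀ k, ‖x k‖ ^ 2 = ∑ t, ‖e.repr (y k) t‖ ^ 2 := fun k => by
    rw [← hn]; rfl
  simp_rw [h1, h2]
  rw [Finset.sum_comm, Finset.sum_comm (s := (Finset.univ : Finset (Fin m))), Finset.mul_sum]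
  refine Finset.sum_le_sum fun t _ => ?_
  have h := Matrix.l2_opNorm_mulVec α (WithLp.toLp 2 fun k => e.repr (y k) t)
  have h' := pow_le_pow_left₀ (norm_nonneg _) h 2
  rw [mul_pow, EuclideanSpace.norm_sq_eq, EuclideanSpace.norm_sq_eq] at h'
  simpa [Matrix.mulVec, dotProduct] using h'

theorem norm_matToOp_directSum {n m : ℕ} (v : Matrix (Fin n) (Fin n) (H →L[ℂ] H))
    (w : Matrix (Fin m) (Fin m) (H →L[ℂ] H)) :
    ‖matToOp H (n + m) (matDirectSum v w)‖ = max ‖matToOp H n v‖ ‖matToOp H m w‖ := by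
  have hl : ∀ (x : PiLp 2 (fun _ : Fin (n + m) => H)) (i : Fin n),
      matToOp H (n + m) (matDirectSum v w) x (Fin.castAdd m i)
        = matToOp H n v (WithLp.toLp 2 fun j => x (Fin.castAdd m j)) i := fun x i => by
    simp [matDirectSum, Fin.sum_univ_add]
  have hr : ∀ (x : PiLp 2 (fun _ : Fin (n + m) => H)) (i : Fin m),
      matToOp H (n + m) (matDirectSum v w) x (Fin.natAdd n i)
        = matToOp H m w (WithLp.toLp 2 fun j => x (Fin.natAdd n j)) i := fun x i => by
    simp [matDirectSum, Fin.sum_univ_add]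
  have hsq : ∀ x : PiLp 2 (fun _ : Fin (n + m) => H), ‖x‖ ^ 2 =
      ‖(WithLp.toLp 2 fun j => x (Fin.castAdd m j) : PiLp 2 (fun _ : Fin n => H))‖ ^ 2
      + ‖(WithLp.toLp 2 fun j => x (Fin.natAdd n j) : PiLp 2 (fun _ : Fin m => H))‖ ^ 2 :=
    fun x => by simp [PiLp.norm_sq_eq_of_L2, Fin.sum_univ_add]
  apply le_antisymm
  · refine ContinuousLinearMap.opNorm_le_bound _ (le_max_of_le_left (norm_nonneg (matToOp H n v))) fun x => ?_
    refine (sq_le_sq₀ (by positivity) (by positivity)).1 ?_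
    rw [mul_pow, hsq, hsq x, mul_add]
    simp only [hl, hr, ← mul_pow]
    refine add_le_add (pow_le_pow_left₀ (norm_nonneg _) ?_ 2)
      (pow_le_pow_left₀ (norm_nonneg _) ?_ 2)
    · refine ((matToOp H n v).le_opNorm (WithLp.toLp 2 fun j => x (Fin.castAdd m j))).trans
        (mul_le_mul_of_nonneg_right (le_max_left _ _) ?_)
      positivity
    · refine ((matToOp H m w).le_opNorm (WithLp.toLp 2 fun j => x (Fin.natAdd n j))).trans
        (mul_le_mul_of_nonneg_right (le_max_right _ _) ?_)
      positivity
  · apply max_le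
    · refine ContinuousLinearMap.opNorm_le_bound _
        (norm_nonneg (matToOp H (n + m) (matDirectSum v w))) fun x => ?_
      have h := (matToOp H (n + m) (matDirectSum v w)).le_opNorm
        (WithLp.toLp 2 (Fin.append (fun i => x i) 0))
      have h' := pow_le_pow_left₀ (norm_nonneg _) h 2
      refine (sq_le_sq₀ (by positivity) (by positivity)).1 ?_
      rw [mul_pow, hsq, hsq (WithLp.toLp 2 _)] at h'
      simp only [hl, hr, Fin.append_left, Fin.append_right] at h'
      rw [mul_pow]
      refine le_trans (le_add_of_nonneg_right (sq_nonneg _)) (h'.trans (le_of_eq ?_))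
      simp [PiLp.norm_sq_eq_of_L2]
    · refine ContinuousLinearMap.opNorm_le_bound _
        (norm_nonneg (matToOp H (n + m) (matDirectSum v w))) fun x => ?_
      have h := (matToOp H (n + m) (matDirectSum v w)).le_opNorm
        (WithLp.toLp 2 (Fin.append 0 (fun i => x i)))
      have h' := pow_le_pow_left₀ (norm_nonneg _) h 2
      refine (sq_le_sq₀ (by positivity) (by positivity)).1 ?_
      rw [mul_pow, hsq, hsq (WithLp.toLp 2 _)] at h'
      simp only [hl, hr, Fin.append_left, Fin.append_right] at h'
      rw [mul_pow]
      refine le_trans (le_add_of_nonneg_left (sq_nonneg _)) (h'.trans (le_of_eq ?_))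
      simp [PiLp.norm_sq_eq_of_L2]

/-- `B(H)` with its natural matrix norms, `M_n(B(H)) = B(Hⁿ)`. -/
instance instOperatorSpaceBoundedOperators : OperatorSpace (H →L[ℂ] H) where
  matNorm n := (normSeminorm ℂ (PiLp 2 (fun _ : Fin n => H) →L[ℂ] PiLp 2 (fun _ : Fin n => H))).comp
    (matToOp H n)
  matNorm_one b := by
    simp only [Seminorm.comp_apply, coe_normSeminorm]
    apply le_antisymm
    · refine ContinuousLinearMap.opNorm_le_bound _ (norm_nonneg _) fun x => ?_
      simpa [PiLp.norm_eq_of_L2, Real.sqrt_sq] using b.le_opNorm (x 0)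
    · refine ContinuousLinearMap.opNorm_le_bound _
        (norm_nonneg (matToOp H 1 (Matrix.of fun _ _ => b))) fun x => ?_
      have h := (matToOp H 1 (Matrix.of fun _ _ => b)).le_opNorm (WithLp.toLp 2 fun _ => x)
      simpa [PiLp.norm_eq_of_L2, Real.sqrt_sq] using h
  matNorm_directSum v w := norm_matToOp_directSum v w
  matNorm_scalarConj_le {n m} α v β := by
    simp only [Seminorm.comp_apply, coe_normSeminorm]
    refine ContinuousLinearMap.opNorm_le_bound _ (by positivity) fun x => ?_
    let y : PiLp 2 (fun _ : Fin m => H) := WithLp.toLp 2 fun l => ∑ j, β l j • x j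
    have hy : ‖y‖ ≤ ‖β‖ * ‖x‖ := by
      refine (sq_le_sq₀ (by positivity) (by positivity)).1 ?_
      have := scalar_action_bound β (fun j => x j)
      rw [mul_pow, PiLp.norm_sq_eq_of_L2, PiLp.norm_sq_eq_of_L2]
      exact this
    let z := matToOp H m v y
    have hz : ‖z‖ ≤ ‖matToOp H m v‖ * ‖y‖ := ContinuousLinearMap.le_opNorm _ _
    have hx : ‖matToOp H n (scalarConj α v β) x‖ ≤ ‖α‖ * ‖z‖ := by
      refine (sq_le_sq₀ (by positivity) (by positivity)).1 ?_
      have := scalar_action_bound α (fun k => z k)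
      rw [mul_pow, PiLp.norm_sq_eq_of_L2, PiLp.norm_sq_eq_of_L2]
      refine le_trans (le_of_eq ?_) this
      refine Finset.sum_congr rfl fun i _ => ?_
      congr 2
      simp only [z, y, matToOp_apply, scalarConj, Matrix.of_apply, map_sum, map_smul,
        sum_apply, smul_apply, Finset.smul_sum]
      rw [Finset.sum_comm]
      refine Finset.sum_congr rfl fun k _ => ?_
      rw [Finset.sum_comm]
      simp [mul_smul]
    calc _ ≤ _ := hx
      _ ≤ ‖α‖ * (‖matToOp H m v‖ * (‖β‖ * ‖x‖)) := by gcongr; exact hz.trans (by gcongr)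
      _ = _ := by ring

end BoundedOperators

section CompletelyBounded

variable {V : Type u} [NormedAddCommGroup V] [NormedSpace ℂ V] [OperatorSpace V]
variable {W : Type v} [NormedAddCommGroup W] [NormedSpace ℂ W] [OperatorSpace W]

/-- `‖φ_n(x)‖ ≤ C ‖x‖` for all `n` and all `x ∈ M_n(V)`, where `φ_n` applies `φ` entrywise. -/
def CBBound (φ : V →ₗ[ℂ] W) (C : ℝ) : Prop :=
  ∀ (n : ℕ) (x : Matrix (Fin n) (Fin n) V), matNorm n (x.map φ) ≤ C * matNorm n x

variable (V W) in
/-- The space `CB(V, W)` of completely bounded maps. -/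
def CB : Submodule ℂ (V →ₗ[ℂ] W) where
  carrier := {φ | ∃ C : ℝ, 0 ≤ C ∧ CBBound φ C}
  zero_mem' := ⟨0, le_rfl, fun n x => by
    have : x.map (0 : V →ₗ[ℂ] W) = 0 := by ext; simp
    rw [this, map_zero, zero_mul]⟩
  add_mem' := by
    rintro φ ψ ⟨C, hC, h⟩ ⟨D, hD, k⟩
    refine ⟨C + D, add_nonneg hC hD, fun n x => ?_⟩
    have : x.map (φ + ψ) = x.map φ + x.map ψ := by ext; simp
    rw [this, add_mul]
    exact (map_add_le_add _ _ _).trans (add_le_add (h n x) (k n x))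
  smul_mem' := by
    rintro c φ ⟨C, hC, h⟩
    refine ⟨‖c‖ * C, by positivity, fun n x => ?_⟩
    have : x.map (c • φ) = c • x.map φ := by ext; simp
    rw [this, map_smul_eq_mul, mul_assoc]
    exact mul_le_mul_of_nonneg_left (h n x) (norm_nonneg c)

/-- The completely bounded norm, the least `C` with `‖φ_n(x)‖ ≤ C ‖x‖` at all levels. -/
def cbNorm (φ : CB V W) : ℝ := sInf {C : ℝ | 0 ≤ C ∧ CBBound (φ : V →ₗ[ℂ] W) C}

/-- The map has finite-dimensional range. -/
def IsFiniteRank (φ : CB V W) : Prop :=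
  FiniteDimensional ℂ (LinearMap.range (φ : V →ₗ[ℂ] W))

end CompletelyBounded

section MinimalTensorProduct

variable (X : Type u) [NormedAddCommGroup X] [NormedSpace ℂ X]
variable (Y : Type v) [NormedAddCommGroup Y] [NormedSpace ℂ Y] [OperatorSpace Y]

/-- The unit ball of `M_m(Y*) = CB(Y, M_m)`, where `M_m = B(ℂᵐ)`: the completely contractive
maps from `Y` to `M_m`. -/
def CCToMat (m : ℕ) : Type v :=
  {σ : Y →ₗ[ℂ] (EuclideanSpace ℂ (Fin m) →L[ℂ] EuclideanSpace ℂ (Fin m)) // CBBound σ 1}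

variable {Y}

/-- The `(i,j)` entry of `σ : Y → M_m`, as a functional on `Y`. -/
def CCToMat.entry {m : ℕ} (σ : CCToMat Y m) (i j : Fin m) : Y →ₗ[ℂ] ℂ where
  toFun y := (Matrix.toEuclideanCLM (n := Fin m) (𝕜 := ℂ)).symm (σ.1 y) i j
  map_add' y z := by simp
  map_smul' c y := by simp

/-- The map `id ⊗ σ : X ⊗ Y → X ⊗ M_m = M_m(X)`, `x ⊗ y ↦ [σ_{ij}(y) x]`. -/
def CCToMat.slice {m : ℕ} (σ : CCToMat Y m) : X ⊗[ℂ] Y →ₗ[ℂ] Matrix (Fin m) (Fin m) X :=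
  TensorProduct.lift
    { toFun := fun x =>
        { toFun := fun y => Matrix.of fun i j => σ.entry i j y • x
          map_add' := fun y z => by ext; simp [add_smul]
          map_smul' := fun c y => by ext; simp [mul_smul] }
      map_add' := fun x z => by ext; simp
      map_smul' := fun c x => by ext y i j; exact smul_comm (σ.entry i j y) c x }

variable {X} in
theorem CCToMat.slice_tmul {m : ℕ} (σ : CCToMat Y m) (x : X) (y : Y) :
    σ.slice X (x ⊗ₜ y) = Matrix.of fun i j => σ.entry i j y • x := rfl

variable [OperatorSpace X] (Y)

/-- The minimal operator space tensor norm on the algebraic tensor product `X ⊗ Y`, i.e. the norm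
inherited from `CB(Y*, X)`: the supremum of `‖(id ⊗ σ)(u)‖` in `M_m(X)` over all `m` and
all `σ` in the unit ball of `M_m(Y*)`. -/
def minSeminorm : Seminorm ℂ (X ⊗[ℂ] Y) :=
  ⨆ s : Σ m : ℕ, CCToMat Y m, (matNorm s.1).comp (s.2.slice X)

theorem minSeminorm_bddAbove : BddAbove (Set.range fun s : Σ m : ℕ, CCToMat Y m =>
    ((matNorm s.1).comp (s.2.slice X) : Seminorm ℂ (X ⊗[ℂ] Y))) := by
  rw [Seminorm.bddAbove_range_iff]
  intro u
  induction u with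
  | zero => exact ⟨0, by rintro _ ⟨s, rfl⟩; simp⟩
  | tmul x y =>
    refine ⟨‖y‖ * ‖x‖, ?_⟩
    rintro _ ⟨⟨m, σ⟩, rfl⟩
    simp only [Seminorm.comp_apply, CCToMat.slice_tmul]
    refine (matNorm_smul_le ((Matrix.toEuclideanCLM (n := Fin m) (𝕜 := ℂ)).symm (σ.1 y)) x).trans
      (mul_le_mul_of_nonneg_right ?_ (norm_nonneg x))
    rw [← Matrix.l2_opNorm_toEuclideanCLM, StarAlgEquiv.apply_symm_apply]
    have h := σ.2 1 (Matrix.of fun _ _ => y)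
    have e : (Matrix.of fun (_ _ : Fin 1) => y).map σ.1 = Matrix.of fun _ _ => σ.1 y := rfl
    rwa [e, OperatorSpace.matNorm_one, OperatorSpace.matNorm_one, one_mul] at h
  | add u v hu hv =>
    obtain ⟨a, ha⟩ := hu
    obtain ⟨b, hb⟩ := hv
    refine ⟨a + b, ?_⟩
    rintro _ ⟨s, rfl⟩
    exact (map_add_le_add _ _ _).trans (add_le_add (ha ⟨s, rfl⟩) (hb ⟨s, rfl⟩))

theorem minSeminorm_apply (u : X ⊗[ℂ] Y) :
    minSeminorm X Y u = ⨆ s : Σ m : ℕ, CCToMat Y m, matNorm s.1 (s.2.slice X u) :=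
  Seminorm.iSup_apply (minSeminorm_bddAbove X Y)

/-- The algebraic tensor product with the minimal operator space tensor norm. -/
def MinTensor : Type (max u v) := X ⊗[ℂ] Y

instance : AddCommGroup (MinTensor X Y) := inferInstanceAs (AddCommGroup (X ⊗[ℂ] Y))

instance : Module ℂ (MinTensor X Y) := inferInstanceAs (Module ℂ (X ⊗[ℂ] Y))

instance : SeminormedAddCommGroup (MinTensor X Y) :=
  AddGroupSeminorm.toSeminormedAddCommGroup (minSeminorm X Y).toAddGroupSeminorm

theorem MinTensor.norm_def (u : MinTensor X Y) : ‖u‖ = minSeminorm X Y u := rfl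

instance : NormedSpace ℂ (MinTensor X Y) where
  norm_smul_le c u := (map_smul_eq_mul (minSeminorm X Y) c u).le

/-- The completed minimal operator space tensor product. -/
abbrev CompletedMinTensor : Type (max u v) := UniformSpace.Completion (MinTensor X Y)

variable {X} {X' : Type w} [NormedAddCommGroup X'] [NormedSpace ℂ X'] [OperatorSpace X']

theorem minSeminorm_map_le (φ : X →ₗ[ℂ] X') {C : ℝ} (hC : 0 ≤ C) (h : CBBound φ C)
    (u : X ⊗[ℂ] Y) : minSeminorm X' Y (φ.rTensor Y u) ≤ C * minSeminorm X Y u := by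
  have hs : ∀ s : Σ m : ℕ, CCToMat Y m,
      s.2.slice X' (φ.rTensor Y u) = (s.2.slice X u).map φ := fun s => by
    induction u with
    | zero => ext; simp
    | tmul x y => ext; simp [CCToMat.slice_tmul]
    | add u v hu hv => rw [map_add, map_add, hu, hv]; ext; simp
  rw [minSeminorm_apply, minSeminorm_apply]
  refine Real.iSup_le (fun s => ?_)
    (mul_nonneg hC (Real.iSup_nonneg fun s => apply_nonneg _ _))
  rw [hs]
  exact (h _ _).trans (mul_le_mul_of_nonneg_left
    (le_ciSup (Seminorm.bddAbove_range_iff.1 (minSeminorm_bddAbove X Y) u) s) hC)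

/-- The map `φ ⊗ id` on the algebraic tensor products, bounded for the minimal norms. -/
def algTensorId (φ : CB X X') : MinTensor X Y →L[ℂ] MinTensor X' Y :=
  LinearMap.mkContinuousOfExistsBound (E := MinTensor X Y) (F := MinTensor X' Y)
    ((φ : X →ₗ[ℂ] X').rTensor Y) (φ.2.imp fun _ h => minSeminorm_map_le Y _ h.1 h.2)

/-- The map `φ ⊗ id` on the completed minimal tensor products. -/
def tensorId (φ : CB X X') : CompletedMinTensor X Y →L[ℂ] CompletedMinTensor X' Y :=
  (algTensorId Y φ).completion

end MinimalTensorProduct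

section StrongApproximation

variable (V : Type u) [NormedAddCommGroup V] [NormedSpace ℂ V] [OperatorSpace V]
variable (W : Type u) [NormedAddCommGroup W] [NormedSpace ℂ W] [OperatorSpace W]

/-- The strongly stable point-norm topology on `CB(V, W)`: the coarsest topology such that
`φ ↦ (φ ⊗ id)(a)` is norm continuous for every Hilbert space `H` and every `a` in the completed
minimal tensor product of `V` and `B(H)`. -/
@[reducible] def stronglyStablePointNormTopology : TopologicalSpace (CB V W) :=
  ⨅ (H : Type u) (_ : NormedAddCommGroup H) (_ : InnerProductSpace ℂ H) (_ : CompleteSpace H)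
    (a : CompletedMinTensor V (H →L[ℂ] H)),
    TopologicalSpace.induced (fun φ : CB V W => tensorId (H →L[ℂ] H) φ a) inferInstance

/-- The identity map, as a completely bounded map. -/
def CB.id : CB V V :=
  ⟨LinearMap.id, 1, zero_le_one, fun n x => by
    have : x.map (LinearMap.id : V →ₗ[ℂ] V) = x := by ext; simp
    rw [this, one_mul]⟩

/-- The strong operator approximation property: the identity is a limit of completely bounded
finite rank maps in the strongly stable point-norm topology. -/
def HasStrongOperatorApproximationProperty : Prop :=
  CB.id V ∈ @closure (CB V V) (stronglyStablePointNormTopology V V) {φ | IsFiniteRank φ}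

end StrongApproximation

section CompleteCompactness

variable {V : Type u} [NormedAddCommGroup V] [NormedSpace ℂ V] [OperatorSpace V]
variable {W : Type v} [NormedAddCommGroup W] [NormedSpace ℂ W] [OperatorSpace W]

variable (V) in
/-- A matrix set in `V`: a set of `n × n` matrices over `V` for each `n`. -/
abbrev MatrixSet : Type u := ∀ n : ℕ, Set (Matrix (Fin n) (Fin n) V)

/-- The levelwise norm closure. -/
def MatrixSet.closure (K : MatrixSet V) : MatrixSet V :=
  fun n => {x | ∀ ε : ℝ, 0 < ε → ∃ y ∈ K n, matNorm n (x - y) < ε}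

/-- A matrix set is completely compact if it is closed, completely bounded, and for each `ε > 0`
all its points are, at all levels, within `ε` of the matrices over a single finite-dimensional
subspace. -/
def MatrixSet.IsCompletelyCompact (K : MatrixSet V) : Prop :=
  (∀ n, MatrixSet.closure K n ⊆ K n) ∧
  (∃ C : ℝ, ∀ n, ∀ x ∈ K n, matNorm n x ≤ C) ∧
  ∀ ε : ℝ, 0 < ε → ∃ E : Submodule ℂ V, FiniteDimensional ℂ E ∧
    ∀ n, ∀ x ∈ K n, ∃ y : Matrix (Fin n) (Fin n) V, (∀ i j, y i j ∈ E) ∧ matNorm n (x - y) < ε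

variable (W) in
/-- The matrix unit ball. -/
def matrixUnitBall : MatrixSet W := fun n => {x | matNorm n x ≤ 1}

/-- The image of a matrix set under a linear map, applied entrywise. -/
def MatrixSet.image (φ : W →ₗ[ℂ] V) (K : MatrixSet W) : MatrixSet V :=
  fun n => (fun x => x.map φ) '' K n

/-- A map is completely compact if the (closed) image of the matrix unit ball is completely
compact. -/
def IsCompletelyCompactMap (φ : CB W V) : Prop :=
  (MatrixSet.closure (MatrixSet.image (φ : W →ₗ[ℂ] V) (matrixUnitBall W))).IsCompletelyCompact

end CompleteCompactness

end

/-! Suppose first that `V` has the approximation property and let φ : W → V be completely compact.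
Collect the images φ_n(x) of all matrices x in all unit balls as the blocks of one block diagonal
object over the Hilbert sum H = ⊕ ℂⁿ, indexed by the pairs (n, x). Complete compactness approximates
this family, uniformly in the block, by families over finite-dimensional subspaces, and such
families are algebraic tensors in V ⊗ B(H) (`exists_blockFamily_slice_eq`). The minimal norm of a
block diagonal tensor is at most the supremum of its block norms (`minSeminorm_blockFamily_le`), so
the approximants are Cauchy and define one element a of the completed tensor product. A finite rank
α with (α ⊗ id)(a) near a is then near the identity on every block, which says that αφ is near φ in
cb norm.

The block norm estimate needs the norm of M_m(V) to be detected by complete contractions V → M_m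
(`exists_norming_contraction`). This is a Hahn–Banach argument: a norming functional on M_m(V) is
dominated by two positive functionals on scalar matrices, whose density matrices, made invertible by
a small perturbation, turn the functional into a map to M_m.

Conversely, take finitely many tensors a_i in V ⊗ B(H_i). Expand them in rapidly convergent series
of algebraic tensors whose k-th terms all live over one finite-dimensional E_k. The map x ↦ ∑ 2⁻ᵏ
x_k from the ℓ^∞ sum of the E_k to V, divided by its kernel, gives an injective completely compact j
: W → V with every a_i in the range of j ⊗ id (`exists_injective_factorization`). By hypothesis j is
a cb limit of finite rank maps W → V, but what is needed are finite rank maps on V, that is,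
functionals on W of the form g ∘ j. Here injectivity enters (`tensorId_rankOne_mem`): a continuous
functional on the tensor product, viewed as a function of the functional f on W that is sliced, is
evaluation at a point of W, and a point killed by all g ∘ j is zero. Hence the closed subspace
produced by maps on V already contains everything produced by finite rank maps on W, and the a_i
themselves. -/

noncomputable section

open OperatorSpace (matNorm)

/-! ### Matrix norms through bilinear forms and Hilbert–Schmidt norms -/

/-- The squared Hilbert–Schmidt norm of a scalar matrix. -/
def sumSq {n m : ℕ} (A : Matrix (Fin n) (Fin m) ℂ) : ℝ := ∑ i, ∑ j, ‖A i j‖ ^ 2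

theorem sumSq_nonneg {n m : ℕ} (A : Matrix (Fin n) (Fin m) ℂ) : 0 ≤ sumSq A := by
  unfold sumSq; positivity

/-- The arithmetic-mean form of the operator norm bound. It is linear in the squared norms, which is
what lets the Hahn–Banach argument below work with real-linear functionals. -/
theorem opNorm_le_of_re_inner_le {E F : Type*} [NormedAddCommGroup E] [InnerProductSpace ℂ E]
    [NormedAddCommGroup F] [InnerProductSpace ℂ F] (T : E →L[ℂ] F) {C : ℝ} (hC : 0 ≤ C)
    (h : ∀ x y, (inner ℂ y (T x)).re ≤ C / 2 * (‖x‖ ^ 2 + ‖y‖ ^ 2)) : ‖T‖ ≤ C := by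
  refine T.opNorm_le_bound hC fun x => ?_
  rcases eq_or_ne (T x) 0 with h0 | h0
  · rw [h0, norm_zero]; positivity
  have ht : 0 < ‖T x‖ := norm_pos_iff.2 h0
  -- The test vector is parallel to `T x` and has norm `‖x‖`, so the mean of the squares equals the
  -- product of the norms.
  have h1 := h x (((‖x‖ / ‖T x‖ : ℝ) : ℂ) • T x)
  have e2 : inner ℂ (T x) (T x) = (((‖T x‖ ^ 2 : ℝ)) : ℂ) := by
    rw [inner_self_eq_norm_sq_to_K]; push_cast; rfl
  rw [inner_smul_left, Complex.conj_ofReal, e2, ← Complex.ofReal_mul, Complex.ofReal_re, norm_smul,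
    Complex.norm_real, Real.norm_of_nonneg (by positivity)] at h1
  have e3 : ‖x‖ / ‖T x‖ * ‖T x‖ = ‖x‖ := by field_simp
  rw [e3] at h1
  have e4 : ‖x‖ / ‖T x‖ * ‖T x‖ ^ 2 = ‖x‖ * ‖T x‖ := by field_simp
  rw [e4] at h1
  have hx : 0 < ‖x‖ := by
    rw [norm_pos_iff]; rintro rfl; simp at h0
  nlinarith

theorem re_inner_le_opNorm {E F : Type*} [NormedAddCommGroup E] [InnerProductSpace ℂ E]
    [NormedAddCommGroup F] [InnerProductSpace ℂ F] (T : E →L[ℂ] F) (x : E) (y : F) :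
    (inner ℂ y (T x)).re ≤ ‖T‖ / 2 * (‖x‖ ^ 2 + ‖y‖ ^ 2) := by
  have h1 : (inner ℂ y (T x)).re ≤ ‖y‖ * ‖T x‖ :=
    (Complex.re_le_norm _).trans (norm_inner_le_norm _ _)
  have h2 := T.le_opNorm x
  have h3 : ‖y‖ * ‖T x‖ ≤ ‖y‖ * (‖T‖ * ‖x‖) := by gcongr
  nlinarith [mul_nonneg (norm_nonneg T) (sq_nonneg (‖x‖ - ‖y‖))]

/-- The matrix of an operator on `ℂᵐ`. -/
abbrev opMatrix {m : ℕ} (T : EuclideanSpace ℂ (Fin m) →L[ℂ] EuclideanSpace ℂ (Fin m)) :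
    Matrix (Fin m) (Fin m) ℂ :=
  (Matrix.toEuclideanCLM (n := Fin m) (𝕜 := ℂ)).symm T

theorem opMatrix_apply_sum {m : ℕ} (T : EuclideanSpace ℂ (Fin m) →L[ℂ] EuclideanSpace ℂ (Fin m))
    (x : EuclideanSpace ℂ (Fin m)) (i : Fin m) : T x i = ∑ j, opMatrix T i j * x j := by
  conv_lhs => rw [← (Matrix.toEuclideanCLM (n := Fin m) (𝕜 := ℂ)).apply_symm_apply T]
  rw [Matrix.ofLp_toEuclideanCLM]
  rfl

/-- The bilinear form associated with a matrix of matrices. -/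
def arrayForm {n m : ℕ} (a : Fin n → Fin n → Fin m → Fin m → ℂ) (Y : Matrix (Fin m) (Fin n) ℂ)
    (X : Matrix (Fin n) (Fin m) ℂ) : ℂ :=
  ∑ p, ∑ q, ∑ i, ∑ j, Y i p * X q j * a p q i j

theorem inner_matToOp_eq_arrayForm {n m : ℕ}
    (b : Matrix (Fin n) (Fin n) (EuclideanSpace ℂ (Fin m) →L[ℂ] EuclideanSpace ℂ (Fin m)))
    (x y : PiLp 2 (fun _ : Fin n => EuclideanSpace ℂ (Fin m))) :
    inner ℂ y (matToOp _ n b x) = arrayForm (fun p q => opMatrix (b p q))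
      (Matrix.of fun i p => star (y p i)) (Matrix.of fun q j => x q j) := by
  rw [PiLp.inner_apply]
  unfold arrayForm
  refine Finset.sum_congr rfl fun p _ => ?_
  rw [matToOp_apply, inner_sum]
  refine Finset.sum_congr rfl fun q _ => ?_
  rw [PiLp.inner_apply]
  refine Finset.sum_congr rfl fun i _ => ?_
  rw [opMatrix_apply_sum, inner_sum]
  refine Finset.sum_congr rfl fun j _ => ?_
  simp only [RCLike.inner_apply, Matrix.of_apply, RCLike.star_def]
  ring

theorem norm_sq_eq_sumSq {n m : ℕ} (x : PiLp 2 (fun _ : Fin n => EuclideanSpace ℂ (Fin m))) :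
    ‖x‖ ^ 2 = sumSq (Matrix.of fun q j => x q j) := by
  simp [PiLp.norm_sq_eq_of_L2, sumSq]

theorem norm_sq_eq_sumSq_star {n m : ℕ} (x : PiLp 2 (fun _ : Fin n => EuclideanSpace ℂ (Fin m))) :
    ‖x‖ ^ 2 = sumSq (Matrix.of fun j q => star (x q j)) := by
  rw [norm_sq_eq_sumSq]
  simp only [sumSq, Matrix.of_apply, norm_star]
  exact Finset.sum_comm

/-- The conjugates of the left vector are absorbed into `Y`, so the criterion is bilinear with no
star. Exchanging matrix levels or changing variables by invertible matrices then becomes plain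
algebra. -/
theorem matNorm_op_le_iff {n m : ℕ}
    (b : Matrix (Fin n) (Fin n) (EuclideanSpace ℂ (Fin m) →L[ℂ] EuclideanSpace ℂ (Fin m)))
    {C : ℝ} (hC : 0 ≤ C) : matNorm n b ≤ C ↔ ∀ Y X,
      (arrayForm (fun p q => opMatrix (b p q)) Y X).re ≤ C / 2 * (sumSq X + sumSq Y) := by
  change ‖matToOp _ n b‖ ≤ C ↔ _
  constructor
  · intro h Y X
    let x : PiLp 2 (fun _ : Fin n => EuclideanSpace ℂ (Fin m)) :=
      WithLp.toLp 2 fun q => WithLp.toLp 2 fun j => X q j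
    let y : PiLp 2 (fun _ : Fin n => EuclideanSpace ℂ (Fin m)) :=
      WithLp.toLp 2 fun q => WithLp.toLp 2 fun j => star (Y j q)
    have h1 := re_inner_le_opNorm (matToOp _ n b) x y
    rw [inner_matToOp_eq_arrayForm, norm_sq_eq_sumSq, norm_sq_eq_sumSq_star y] at h1
    have ex : (Matrix.of fun q j => x q j) = X := rfl
    have ey : (Matrix.of fun i p => star (y p i)) = Y := by ext i p; simp [y]
    rw [ex, ey] at h1
    refine h1.trans ?_
    have := sumSq_nonneg X
    have := sumSq_nonneg Y
    gcongr
  · intro h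
    refine opNorm_le_of_re_inner_le _ hC fun x y => ?_
    rw [inner_matToOp_eq_arrayForm, norm_sq_eq_sumSq, norm_sq_eq_sumSq_star y]
    exact h _ _

/-- Transposition of the two matrix levels does not change the norm. -/
theorem matNorm_le_of_shuffle {n m : ℕ}
    (b : Matrix (Fin n) (Fin n) (EuclideanSpace ℂ (Fin m) →L[ℂ] EuclideanSpace ℂ (Fin m)))
    (c : Matrix (Fin m) (Fin m) (EuclideanSpace ℂ (Fin n) →L[ℂ] EuclideanSpace ℂ (Fin n)))
    (h : ∀ p q i j, opMatrix (b p q) i j = opMatrix (c i j) p q) : matNorm n b ≤ matNorm m c := by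
  rw [matNorm_op_le_iff b (apply_nonneg _ _)]
  intro Y X
  -- Exchanging the two levels transposes `X` and `Y`, which leaves their Hilbert–Schmidt norms
  -- unchanged.
  have e : arrayForm (fun p q => opMatrix (b p q)) Y X
      = arrayForm (fun i j => opMatrix (c i j)) Yᵀ Xᵀ := by
    unfold arrayForm
    simp only [h, Matrix.transpose_apply]
    calc _ = ∑ p, ∑ i, ∑ q, ∑ j, Y i p * X q j * opMatrix (c i j) p q :=
          Finset.sum_congr rfl fun p _ => Finset.sum_comm
      _ = ∑ i, ∑ p, ∑ j, ∑ q, Y i p * X q j * opMatrix (c i j) p q := by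
          rw [Finset.sum_comm]
          exact Finset.sum_congr rfl fun i _ => Finset.sum_congr rfl fun p _ => Finset.sum_comm
      _ = _ := Finset.sum_congr rfl fun i _ => Finset.sum_comm
  have hs : ∀ {a b : ℕ} (Z : Matrix (Fin a) (Fin b) ℂ), sumSq Zᵀ = sumSq Z := fun Z => by
    simp only [sumSq, Matrix.transpose_apply]; exact Finset.sum_comm
  have h2 := (matNorm_op_le_iff c (apply_nonneg _ _)).1 le_rfl Yᵀ Xᵀ
  rw [e]
  rwa [hs, hs] at h2

theorem l2_opNorm_row_sq {m : ℕ} (a : Fin m → ℂ) :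
    ‖(Matrix.of fun (_ : Fin 1) k => a k)‖ ^ 2 ≤ ∑ k, ‖a k‖ ^ 2 := by
  set A : Matrix (Fin 1) (Fin m) ℂ := Matrix.of fun (_ : Fin 1) k => a k
  have h := Matrix.l2_opNorm_conjTranspose_mul_self Aᴴ
  rw [Matrix.conjTranspose_conjTranspose, Matrix.l2_opNorm_conjTranspose] at h
  have e : A * Aᴴ = ((∑ k, ‖a k‖ ^ 2 : ℝ) : ℂ) • (1 : Matrix (Fin 1) (Fin 1) ℂ) := by
    ext i j
    simp [A, Matrix.mul_apply, Subsingleton.elim i j, Complex.mul_conj, Complex.normSq_eq_norm_sq]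
  rw [e, norm_smul, CStarRing.norm_one, mul_one, Complex.norm_real,
    Real.norm_of_nonneg (by positivity)] at h
  rw [sq, ← h]

section

variable {V : Type u} [NormedAddCommGroup V] [NormedSpace ℂ V] [OperatorSpace V]

/-- The sum is the compression of `v` to a 1 × 1 matrix by a scalar row and a scalar column, whose
operator norms are at most their ℓ² norms. -/
theorem norm_sum_smul_le {m : ℕ} (v : Matrix (Fin m) (Fin m) V) (a b : Fin m → ℂ) :
    ‖∑ k, ∑ l, (a k * b l) • v k l‖ ≤ matNorm m v / 2 * (∑ k, ‖a k‖ ^ 2 + ∑ k, ‖b k‖ ^ 2) := by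
  set A : Matrix (Fin 1) (Fin m) ℂ := Matrix.of fun _ k => a k
  set B : Matrix (Fin 1) (Fin m) ℂ := Matrix.of fun _ k => star (b k)
  have h := OperatorSpace.matNorm_scalarConj_le A v Bᴴ
  have e : scalarConj A v Bᴴ = Matrix.of fun _ _ => ∑ k, ∑ l, (a k * b l) • v k l := by
    ext i j; simp [scalarConj, A, B]
  rw [e, OperatorSpace.matNorm_one, Matrix.l2_opNorm_conjTranspose] at h
  have hA := l2_opNorm_row_sq a
  have hB := l2_opNorm_row_sq (fun k => star (b k))
  simp only [norm_star] at hB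
  change ‖A‖ ^ 2 ≤ _ at hA
  change ‖B‖ ^ 2 ≤ _ at hB
  have hv : 0 ≤ matNorm m v := apply_nonneg _ _
  nlinarith [mul_nonneg hv (sq_nonneg (‖A‖ - ‖B‖)), mul_le_mul_of_nonneg_left hA hv,
    mul_le_mul_of_nonneg_left hB hv]

/-- Functionals are completely bounded with the same norm. -/
theorem norm_functional_matrix_le (f : V →L[ℂ] ℂ) {n : ℕ} (v : Matrix (Fin n) (Fin n) V) :
    ‖v.map f‖ ≤ ‖f‖ * matNorm n v := by
  rw [← Matrix.l2_opNorm_toEuclideanCLM]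
  refine opNorm_le_of_re_inner_le _ (mul_nonneg (norm_nonneg _) (apply_nonneg _ _)) fun x y => ?_
  -- The form of `v.map f` is `f` at a single vector of `V`, so only the level-one norm of `f`
  -- enters.
  have e : inner ℂ y (Matrix.toEuclideanCLM (n := Fin n) (𝕜 := ℂ) (v.map f) x)
      = f (∑ k, ∑ l, (star (y k) * x l) • v k l) := by
    rw [PiLp.inner_apply, map_sum]
    refine Finset.sum_congr rfl fun k _ => ?_
    rw [Matrix.ofLp_toEuclideanCLM, map_sum]
    simp only [Matrix.mulVec, dotProduct, inner_sum]
    refine Finset.sum_congr rfl fun l _ => ?_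
    simp only [RCLike.inner_apply, Matrix.map_apply, map_smul, smul_eq_mul, RCLike.star_def]
    ring
  rw [e]
  refine (Complex.re_le_norm _).trans ((f.le_opNorm _).trans ?_)
  rw [mul_div_assoc, mul_assoc]
  refine mul_le_mul_of_nonneg_left ((norm_sum_smul_le v _ _).trans (le_of_eq ?_)) (norm_nonneg _)
  rw [EuclideanSpace.norm_sq_eq, EuclideanSpace.norm_sq_eq]
  simp only [norm_star]
  ring

theorem CBBound_smulRight {W : Type v} [NormedAddCommGroup W] [NormedSpace ℂ W] [OperatorSpace W]
    (f : V →L[ℂ] ℂ) (w : W) : CBBound ((f : V →ₗ[ℂ] ℂ).smulRight w) (‖f‖ * ‖w‖) := by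
  intro n x
  refine (matNorm_smul_le (x.map f) w).trans ?_
  calc _ ≤ (‖f‖ * matNorm n x) * ‖w‖ := by gcongr; exact norm_functional_matrix_le f x
    _ = _ := by ring

end

/-! ### Norming `M_m(V)` by complete contractions into `M_m` -/

/-- A sandwich form of the Hahn–Banach theorem, for a sublinear functional that dominates a
linear functional on a convex cone. -/
theorem exists_linear_between {E : Type*} [AddCommGroup E] [Module ℝ E] {ι : Type*} (N : E → ℝ)
    (N_smul : ∀ t : ℝ, 0 < t → ∀ x, N (t • x) = t * N x) (N_add : ∀ x y, N (x + y) ≤ N x + N y)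
    (g : ι → E) (c : ι → ℝ) (hle : ∀ i, c i ≤ N (g i))
    (hadd : ∀ i j, ∃ k, g k = g i + g j ∧ c k = c i + c j)
    (hsmul : ∀ t : ℝ, 0 < t → ∀ i, ∃ k, g k = t • g i ∧ c k = t * c i)
    (hzero : ∃ i, g i = 0 ∧ c i = 0) :
    ∃ l : E →ₗ[ℝ] ℝ, (∀ x, l x ≤ N x) ∧ ∀ i, c i ≤ l (g i) := by
  obtain ⟨i₀, hg0, hc0⟩ := hzero
  have : Nonempty ι := ⟨i₀⟩
  -- Infimal convolution of `N` with the cone. A linear functional below `M` is below `N` because of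
  -- the zero element of the cone, and at `-g i` the bound by `M` gives the lower bound `c i` at `g
  -- i`. So Hahn–Banach can start from the zero subspace.
  let M : E → ℝ := fun x => ⨅ i, (N (x + g i) - c i)
  have hlow : ∀ x i, -N (-x) ≤ N (x + g i) - c i := fun x i => by
    have h1 := N_add (x + g i) (-x)
    rw [add_neg_cancel_comm] at h1
    linarith [hle i]
  have hbdd : ∀ x, BddBelow (Set.range fun i => N (x + g i) - c i) := fun x =>
    ⟨-N (-x), by rintro _ ⟨i, rfl⟩; exact hlow x i⟩
  have hM : ∀ x i, M x ≤ N (x + g i) - c i := fun x i => ciInf_le (hbdd x) i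
  have hM_add : ∀ x y, M (x + y) ≤ M x + M y := fun x y => by
    refine le_ciInf_add_ciInf fun i j => ?_
    obtain ⟨k, hk, hk'⟩ := hadd i j
    have h1 := hM (x + y) k
    have h2 := N_add (x + g i) (y + g j)
    have e : x + y + g k = x + g i + (y + g j) := by rw [hk]; abel
    rw [e, hk'] at h1
    linarith
  have hM_le : ∀ t : ℝ, 0 < t → ∀ x, M (t • x) ≤ t * M x := fun t ht x => by
    change _ ≤ t * ⨅ i, _
    rw [Real.mul_iInf_of_nonneg ht.le]
    refine le_ciInf fun i => ?_
    obtain ⟨k, hk, hk'⟩ := hsmul t ht i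
    have h1 := hM (t • x) k
    rw [hk, ← smul_add, N_smul t ht, hk'] at h1
    linarith
  have hM_smul : ∀ t : ℝ, 0 < t → ∀ x, M (t • x) = t * M x := fun t ht x => by
    refine le_antisymm (hM_le t ht x) ?_
    have h1 := hM_le t⁻¹ (inv_pos.2 ht) (t • x)
    rw [smul_smul, inv_mul_cancel₀ ht.ne', one_smul] at h1
    calc t * M x ≤ t * (t⁻¹ * M (t • x)) := by gcongr
      _ = _ := by field_simp
  have hN0 : N 0 = 0 := by
    have := N_smul 2 two_pos 0
    rw [smul_zero] at this
    linarith
  obtain ⟨l, -, hl⟩ := exists_extension_of_le_sublinear (⊥ : E →ₗ.[ℝ] ℝ) M hM_smul hM_add (by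
    rintro ⟨x, hx⟩
    have hx0 : x = 0 := (Submodule.mem_bot ℝ).1 hx
    subst hx0
    have e : (⊥ : E →ₗ.[ℝ] ℝ) ⟨0, hx⟩ = 0 := LinearPMap.map_zero _
    rw [e]
    refine le_ciInf fun i => ?_
    have := hlow 0 i
    rw [neg_zero, hN0, neg_zero] at this
    exact this)
  refine ⟨l, fun x => ?_, fun i => ?_⟩
  · have := (hl x).trans (hM x i₀)
    rwa [hg0, hc0, add_zero, sub_zero] at this
  · have := (hl (-g i)).trans (hM (-g i) i)
    rw [map_neg, neg_add_cancel, hN0] at this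
    linarith

/-- A row of two rectangular matrices. -/
def rowPair {m r s : ℕ} (α : Matrix (Fin m) (Fin r) ℂ) (γ : Matrix (Fin m) (Fin s) ℂ) :
    Matrix (Fin m) (Fin (r + s)) ℂ := Matrix.of fun i => Fin.append (α i) (γ i)

theorem rowPair_mul_conjTranspose {m r s : ℕ} (α : Matrix (Fin m) (Fin r) ℂ)
    (γ : Matrix (Fin m) (Fin s) ℂ) :
    rowPair α γ * (rowPair α γ)ᴴ = α * αᴴ + γ * γᴴ := by
  ext i j
  simp [rowPair, Matrix.mul_apply, Fin.sum_univ_add]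

theorem scalarConj_rowPair {V : Type u} [AddCommGroup V] [Module ℂ V] {m r s : ℕ}
    (α β : Matrix (Fin m) (Fin r) ℂ)
    (γ δ : Matrix (Fin m) (Fin s) ℂ) (v : Matrix (Fin r) (Fin r) V)
    (w : Matrix (Fin s) (Fin s) V) :
    scalarConj (rowPair α γ) (matDirectSum v w) (rowPair β δ)ᴴ
      = scalarConj α v βᴴ + scalarConj γ w δᴴ := by
  ext i j
  simp [rowPair, scalarConj, matDirectSum, Fin.sum_univ_add]

section

variable {V : Type u} [NormedAddCommGroup V] [NormedSpace ℂ V] [OperatorSpace V]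

/-- The triples (α, β, v) with ‖v‖ ≤ 1 behave as a convex cone: two of them add by forming the rows
[α γ], [β δ] and the direct sum v ⊕ w, whose norm is a maximum and so stays at most 1. On this cone
2 Re F(αvβ*) ≤ 2‖α‖‖β‖ ≤ ‖αα*‖ + ‖ββ*‖, and `exists_linear_between` inserts a linear functional. -/
theorem exists_functional_dominating {m : ℕ} (F : Matrix (Fin m) (Fin m) V →ₗ[ℂ] ℂ)
    (hF : ∀ v, ‖F v‖ ≤ matNorm m v) :
    ∃ l : (Matrix (Fin m) (Fin m) ℂ × Matrix (Fin m) (Fin m) ℂ) →ₗ[ℝ] ℝ,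
      (∀ x, l x ≤ ‖x.1‖ + ‖x.2‖) ∧
      ∀ (r : ℕ) (α β : Matrix (Fin m) (Fin r) ℂ) (v : Matrix (Fin r) (Fin r) V),
        matNorm r v ≤ 1 → 2 * (F (scalarConj α v βᴴ)).re ≤ l (α * αᴴ, β * βᴴ) := by
  let ι := Σ r : ℕ, {t : Matrix (Fin m) (Fin r) ℂ × Matrix (Fin m) (Fin r) ℂ ×
    Matrix (Fin r) (Fin r) V // matNorm r t.2.2 ≤ 1}
  obtain ⟨l, h1, h2⟩ := exists_linear_between (ι := ι)
    (fun x : Matrix (Fin m) (Fin m) ℂ × Matrix (Fin m) (Fin m) ℂ => ‖x.1‖ + ‖x.2‖)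
    (fun t ht x => by simp [norm_smul, abs_of_pos ht, mul_add])
    (fun x y => by
      have h1 := norm_add_le x.1 y.1
      have h2 := norm_add_le x.2 y.2
      simp only [Prod.fst_add, Prod.snd_add]
      linarith)
    (fun i => (i.2.1.1 * i.2.1.1ᴴ, i.2.1.2.1 * i.2.1.2.1ᴴ))
    (fun i => 2 * (F (scalarConj i.2.1.1 i.2.1.2.2 i.2.1.2.1ᴴ)).re)
    (by
      rintro ⟨r, ⟨α, β, v⟩, hv⟩
      have h1 := (Complex.re_le_norm _).trans ((hF (scalarConj α v βᴴ)).trans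
        (OperatorSpace.matNorm_scalarConj_le α v βᴴ))
      have h2 : ‖α * αᴴ‖ = ‖α‖ * ‖α‖ := by
        have := Matrix.l2_opNorm_conjTranspose_mul_self αᴴ
        rwa [Matrix.conjTranspose_conjTranspose, Matrix.l2_opNorm_conjTranspose] at this
      have h3 : ‖β * βᴴ‖ = ‖β‖ * ‖β‖ := by
        have := Matrix.l2_opNorm_conjTranspose_mul_self βᴴ
        rwa [Matrix.conjTranspose_conjTranspose, Matrix.l2_opNorm_conjTranspose] at this
      simp only [h2, h3]
      rw [Matrix.l2_opNorm_conjTranspose] at h1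
      change matNorm r v ≤ 1 at hv
      have h4 : ‖α‖ * matNorm r v * ‖β‖ ≤ ‖α‖ * 1 * ‖β‖ := by gcongr
      nlinarith [sq_nonneg (‖α‖ - ‖β‖)])
    (by
      rintro ⟨r, ⟨α, β, v⟩, hv⟩ ⟨s, ⟨γ, δ, w⟩, hw⟩
      refine ⟨⟨r + s, ⟨rowPair α γ, rowPair β δ, matDirectSum v w⟩, ?_⟩, ?_, ?_⟩
      · rw [OperatorSpace.matNorm_directSum]; exact max_le hv hw
      · simp [rowPair_mul_conjTranspose]
      · simp [scalarConj_rowPair, mul_add])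
    (by
      rintro t ht ⟨r, ⟨α, β, v⟩, hv⟩
      -- Scaling by `t` is shared as √t between α and β, so that `v` keeps its norm bound.
      have e : ((Real.sqrt t : ℝ) : ℂ) * ((Real.sqrt t : ℝ) : ℂ) = t := by
        rw [← Complex.ofReal_mul, Real.mul_self_sqrt ht.le]
      have e1 : ∀ a : Matrix (Fin m) (Fin r) ℂ,
          (((Real.sqrt t : ℝ) : ℂ) • a) * (((Real.sqrt t : ℝ) : ℂ) • a)ᴴ = t • (a * aᴴ) := by
        intro a
        ext i j
        simp only [Matrix.mul_apply, Matrix.smul_apply, Matrix.conjTranspose_apply, smul_eq_mul,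
          star_mul', RCLike.star_def, Complex.conj_ofReal, Complex.real_smul, Finset.mul_sum, ← e]
        exact Finset.sum_congr rfl fun k _ => by ring
      refine ⟨⟨r, ⟨((Real.sqrt t : ℝ) : ℂ) • α, ((Real.sqrt t : ℝ) : ℂ) • β, v⟩, hv⟩, ?_, ?_⟩
      · simp only [e1]; rfl
      · have : scalarConj (((Real.sqrt t : ℝ) : ℂ) • α) v (((Real.sqrt t : ℝ) : ℂ) • β)ᴴ
            = (t : ℂ) • scalarConj α v βᴴ := by
          ext i j
          simp only [scalarConj, Matrix.smul_apply, Matrix.conjTranspose_apply, smul_eq_mul,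
            star_mul', RCLike.star_def, Complex.conj_ofReal, Finset.smul_sum, smul_smul,
            Matrix.of_apply, ← e]
          exact Finset.sum_congr rfl fun k _ => Finset.sum_congr rfl fun k _ => by
            congr 1; ring
        simp only [this, map_smul, smul_eq_mul, Complex.re_ofReal_mul]
        ring)
    ⟨⟨0, ⟨0, 0, 0⟩, by simp⟩, by simp, by
      have : scalarConj (0 : Matrix (Fin m) (Fin 0) ℂ) (0 : Matrix (Fin 0) (Fin 0) V)
        (0 : Matrix (Fin m) (Fin 0) ℂ)ᴴ = 0 := by ext; simp [scalarConj]
      change 2 * (F (scalarConj 0 0 0ᴴ)).re = 0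
      rw [this]; simp⟩
  exact ⟨l, h1, fun r α β v hv => h2 ⟨r, ⟨α, β, v⟩, hv⟩⟩

theorem sumSq_eq_trace {n m : ℕ} (A : Matrix (Fin n) (Fin m) ℂ) :
    (sumSq A : ℂ) = (Aᴴ * A).trace := by
  simp only [sumSq, Matrix.trace, Matrix.mul_apply, Matrix.diag, Matrix.conjTranspose_apply]
  rw [Finset.sum_comm]
  push_cast
  refine Finset.sum_congr rfl fun i _ => Finset.sum_congr rfl fun j _ => ?_
  rw [RCLike.star_def, Complex.conj_mul']

open scoped ComplexOrder in
/-- A positive functional on scalar matrices is dominated by a squared Hilbert–Schmidt norm after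
an invertible change of variables. -/
theorem exists_isUnit_dominating {m : ℕ} (p : Matrix (Fin m) (Fin m) ℂ →ₗ[ℝ] ℝ)
    (hp : ∀ (r : ℕ) (α : Matrix (Fin m) (Fin r) ℂ), 0 ≤ p (α * αᴴ)) (hp1 : p 1 ≤ 1) {δ : ℝ}
    (hδ : 0 < δ) : ∃ A : Matrix (Fin m) (Fin m) ℂ, IsUnit A ∧
      (∀ (r : ℕ) (α : Matrix (Fin m) (Fin r) ℂ), p (α * αᴴ) ≤ sumSq (A * α)) ∧
      sumSq A ≤ 1 + δ * m := by
  -- The complex-linear functional X ↦ p(Re X) + i p(Im X). It agrees with `p` on Hermitian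
  -- matrices, the only ones where positivity says anything.
  let q : Matrix (Fin m) (Fin m) ℂ →ₗ[ℂ] ℂ :=
    { toFun := fun X => ((1 / 2 * p (X + Xᴴ) : ℝ) : ℂ)
        - Complex.I * ((1 / 2 * p (Complex.I • (X - Xᴴ)) : ℝ) : ℂ)
      map_add' := fun X Y => by
        have e1 : X + Y + (X + Y)ᴴ = (X + Xᴴ) + (Y + Yᴴ) := by
          rw [Matrix.conjTranspose_add]; abel
        have e2 : Complex.I • (X + Y - (X + Y)ᴴ)
            = Complex.I • (X - Xᴴ) + Complex.I • (Y - Yᴴ) := by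
          rw [Matrix.conjTranspose_add, ← smul_add]; congr 1; abel
        rw [e1, e2, p.map_add (X + Xᴴ), p.map_add (Complex.I • (X - Xᴴ))]; push_cast; ring
      map_smul' := fun c X => by
        have e1 : c • X + (c • X)ᴴ = c.re • (X + Xᴴ) + c.im • (Complex.I • (X - Xᴴ)) := by
          ext i j
          simp only [Matrix.add_apply, Matrix.sub_apply, Matrix.smul_apply,
            Matrix.conjTranspose_apply, smul_eq_mul, star_mul', Complex.real_smul]
          apply Complex.ext <;> simp <;> ring
        have e2 : Complex.I • (c • X - (c • X)ᴴ)
            = c.re • (Complex.I • (X - Xᴴ)) - c.im • (X + Xᴴ) := by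
          ext i j
          simp only [Matrix.add_apply, Matrix.sub_apply, Matrix.smul_apply,
            Matrix.conjTranspose_apply, smul_eq_mul, star_mul', Complex.real_smul]
          apply Complex.ext <;> simp <;> ring
        rw [e1, e2, map_add, map_sub]
        simp only [map_smul, smul_eq_mul, RingHom.id_apply]
        apply Complex.ext <;> simp <;> ring }
  have hq : ∀ X : Matrix (Fin m) (Fin m) ℂ, Xᴴ = X → q X = (p X : ℂ) := fun X hX => by
    change ((1 / 2 * p (X + Xᴴ) : ℝ) : ℂ)
        - Complex.I * ((1 / 2 * p (Complex.I • (X - Xᴴ)) : ℝ) : ℂ) = _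
    rw [hX, sub_self, smul_zero, map_zero, map_add]
    push_cast; ring
  have hqstar : ∀ X : Matrix (Fin m) (Fin m) ℂ, q Xᴴ = star (q X) := fun X => by
    change ((1 / 2 * p (Xᴴ + Xᴴᴴ) : ℝ) : ℂ)
        - Complex.I * ((1 / 2 * p (Complex.I • (Xᴴ - Xᴴᴴ)) : ℝ) : ℂ)
      = star (((1 / 2 * p (X + Xᴴ) : ℝ) : ℂ)
        - Complex.I * ((1 / 2 * p (Complex.I • (X - Xᴴ)) : ℝ) : ℂ))
    have e : Complex.I • (Xᴴ - X) = -(Complex.I • (X - Xᴴ)) := by rw [← smul_neg, neg_sub]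
    rw [Matrix.conjTranspose_conjTranspose, e, map_neg, add_comm Xᴴ X]
    apply Complex.ext <;> simp
  -- The density matrix of `q` for the trace pairing.
  let P : Matrix (Fin m) (Fin m) ℂ := Matrix.of fun k l => q (Matrix.single l k 1)
  have hqP : ∀ X, q X = (P * X).trace := fun X => by
    conv_lhs => rw [Matrix.matrix_eq_sum_single X]
    simp only [map_sum, Matrix.trace, Matrix.diag, Matrix.mul_apply]
    rw [Finset.sum_comm]
    refine Finset.sum_congr rfl fun i _ => Finset.sum_congr rfl fun j _ => ?_
    have : Matrix.single j i (X j i) = X j i • Matrix.single j i (1 : ℂ) := by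
      rw [Matrix.smul_single, smul_eq_mul, mul_one]
    rw [this, map_smul, smul_eq_mul, mul_comm]; rfl
  have hPα : ∀ (r : ℕ) (α : Matrix (Fin m) (Fin r) ℂ),
      (p (α * αᴴ) : ℂ) = (αᴴ * P * α).trace := fun r α => by
    rw [← hq _ (by simp), hqP, Matrix.trace_mul_comm, Matrix.mul_assoc α, Matrix.trace_mul_comm]
  have hPpos : P.PosSemidef := by
    refine Matrix.PosSemidef.of_dotProduct_mulVec_nonneg ?_ fun x => ?_
    · ext k l
      simp only [P, Matrix.conjTranspose_apply, Matrix.of_apply]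
      rw [← hqstar, Matrix.conjTranspose_single, star_one]
    · have h1 := hPα 1 (Matrix.of fun i _ => x i)
      have h2 : ((Matrix.of fun i (_ : Fin 1) => x i)ᴴ * P * (Matrix.of fun i _ => x i)).trace
          = star x ⬝ᵥ P *ᵥ x := by
        rw [Matrix.mul_assoc]
        simp [Matrix.trace, Matrix.mul_apply, dotProduct, Matrix.mulVec]
      rw [← h2, ← h1]
      exact_mod_cast hp 1 _
  -- The perturbation makes the factor `A` invertible. Its price is δ times the squared
  -- Hilbert–Schmidt norm `m` of the identity.
  have hPδ : (P + (δ : ℂ) • 1).PosDef :=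
    Matrix.PosDef.posSemidef_add hPpos (Matrix.PosDef.one.smul (by exact_mod_cast hδ))
  obtain ⟨A, hA⟩ : ∃ A : Matrix (Fin m) (Fin m) ℂ, P + (δ : ℂ) • 1 = Aᴴ * A := by
    open scoped MatrixOrder in
    obtain ⟨A, hA⟩ := CStarAlgebra.nonneg_iff_eq_star_mul_self.1 hPδ.posSemidef.nonneg
    exact ⟨A, hA⟩
  have hsum : ∀ (r : ℕ) (α : Matrix (Fin m) (Fin r) ℂ),
      sumSq (A * α) = p (α * αᴴ) + δ * sumSq α := fun r α => by
    have : (sumSq (A * α) : ℂ) = p (α * αᴴ) + δ * sumSq α := by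
      rw [sumSq_eq_trace, sumSq_eq_trace, hPα, Matrix.conjTranspose_mul, Matrix.mul_assoc,
        ← Matrix.mul_assoc Aᴴ, ← hA, Matrix.add_mul, Matrix.mul_add, Matrix.trace_add,
        ← Matrix.mul_assoc]
      simp
    exact_mod_cast this
  refine ⟨A, ?_, fun r α => ?_, ?_⟩
  · have := hPδ.isUnit
    rw [hA] at this
    exact isUnit_of_mul_isUnit_right this
  · rw [hsum]
    have := sumSq_nonneg α
    nlinarith
  · have := hsum m 1
    rw [Matrix.mul_one, Matrix.conjTranspose_one, Matrix.mul_one] at this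
    have e : sumSq (1 : Matrix (Fin m) (Fin m) ℂ) = m := by
      have := sumSq_eq_trace (1 : Matrix (Fin m) (Fin m) ℂ)
      simp at this
      exact_mod_cast this
    rw [this, e]
    linarith

end

/-- A linear functional on matrices, in terms of its coefficient functionals. -/
theorem functional_scalarConj {V : Type u} [AddCommGroup V] [Module ℂ V] {m r : ℕ}
    (F : Matrix (Fin m) (Fin m) V →ₗ[ℂ] ℂ) (α : Matrix (Fin m) (Fin r) ℂ)
    (v : Matrix (Fin r) (Fin r) V) (β : Matrix (Fin r) (Fin m) ℂ) :
    F (scalarConj α v β)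
      = ∑ p, ∑ q, ∑ k, ∑ l, α k p * β q l * F (Matrix.single k l (v p q)) := by
  have e : scalarConj α v β
      = ∑ p, ∑ q, ∑ k, ∑ l, (α k p * β q l) • Matrix.single k l (v p q) := by
    ext i j
    simp [scalarConj, Matrix.sum_apply, Matrix.single_apply, ite_and]
  rw [e]
  simp only [map_sum, map_smul, smul_eq_mul]

/-- The map `V → M_m` with prescribed coefficient functionals. -/
def mapOfFunctional {V : Type u} [AddCommGroup V] [Module ℂ V] {m : ℕ}
    (F : Matrix (Fin m) (Fin m) V →ₗ[ℂ] ℂ)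
    (C D : Matrix (Fin m) (Fin m) ℂ) :
    V →ₗ[ℂ] (EuclideanSpace ℂ (Fin m) →L[ℂ] EuclideanSpace ℂ (Fin m)) where
  toFun v := Matrix.toEuclideanCLM (n := Fin m) (𝕜 := ℂ)
    (Matrix.of fun i j => ∑ k, ∑ l, C k i * D j l * F (Matrix.single k l v))
  map_add' v w := by
    rw [← map_add]
    congr 1
    ext i j
    simp [Matrix.single_add, mul_add, Finset.sum_add_distrib]
  map_smul' c v := by
    rw [RingHom.id_apply, ← map_smul]
    congr 1
    ext i j
    simp only [Matrix.of_apply, Matrix.smul_apply, smul_eq_mul, Finset.mul_sum,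
      ← Matrix.smul_single, map_smul]
    exact Finset.sum_congr rfl fun k _ => Finset.sum_congr rfl fun l _ => by ring

/-- By this identity, estimating the constructed map at every matrix level amounts to estimating `F`
on two-sided scalar products. -/
theorem arrayForm_mapOfFunctional {V : Type u} [AddCommGroup V] [Module ℂ V] {m r : ℕ}
    (F : Matrix (Fin m) (Fin m) V →ₗ[ℂ] ℂ)
    (C D : Matrix (Fin m) (Fin m) ℂ) (v : Matrix (Fin r) (Fin r) V)
    (Y : Matrix (Fin m) (Fin r) ℂ) (X : Matrix (Fin r) (Fin m) ℂ) :
    arrayForm (fun p q => opMatrix (v.map (mapOfFunctional F C D) p q)) Y X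
      = F (scalarConj (C * Y) v (X * D)) := by
  rw [functional_scalarConj]
  unfold arrayForm
  refine Finset.sum_congr rfl fun p _ => Finset.sum_congr rfl fun q _ => ?_
  have e : ∀ i j, opMatrix (v.map (mapOfFunctional F C D) p q) i j
      = ∑ k, ∑ l, C k i * D j l * F (Matrix.single k l (v p q)) := fun i j => by
    change (Matrix.toEuclideanCLM (n := Fin m) (𝕜 := ℂ)).symm
      (Matrix.toEuclideanCLM (n := Fin m) (𝕜 := ℂ) _) i j = _
    rw [StarAlgEquiv.symm_apply_apply]; rfl
  simp only [e, Matrix.mul_apply, Finset.mul_sum, Finset.sum_mul]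
  calc _ = ∑ i, ∑ k, ∑ j, ∑ l, Y i p * X q j * (C k i * D j l * F (Matrix.single k l (v p q))) :=
        Finset.sum_congr rfl fun i _ => Finset.sum_comm
    _ = ∑ k, ∑ i, ∑ j, ∑ l, Y i p * X q j * (C k i * D j l * F (Matrix.single k l (v p q))) :=
        Finset.sum_comm
    _ = ∑ k, ∑ i, ∑ l, ∑ j, Y i p * X q j * (C k i * D j l * F (Matrix.single k l (v p q))) :=
        Finset.sum_congr rfl fun k _ => Finset.sum_congr rfl fun i _ => Finset.sum_comm
    _ = ∑ k, ∑ l, ∑ i, ∑ j, Y i p * X q j * (C k i * D j l * F (Matrix.single k l (v p q))) :=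
        Finset.sum_congr rfl fun k _ => Finset.sum_comm
    _ = _ := Finset.sum_congr rfl fun k _ => Finset.sum_congr rfl fun l _ =>
        Finset.sum_comm.trans (Finset.sum_congr rfl fun i _ => Finset.sum_congr rfl fun j _ => by
          ring)

section

variable {V : Type u} [NormedAddCommGroup V] [NormedSpace ℂ V] [OperatorSpace V]

theorem exists_norming_matrix_functional {m : ℕ} (v : Matrix (Fin m) (Fin m) V) :
    ∃ F : Matrix (Fin m) (Fin m) V →ₗ[ℂ] ℂ, (∀ w, ‖F w‖ ≤ matNorm m w) ∧
      F v = (matNorm m v : ℂ) := by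
  let _ : SeminormedAddCommGroup (Matrix (Fin m) (Fin m) V) :=
    AddGroupSeminorm.toSeminormedAddCommGroup (matNorm m (V := V)).toAddGroupSeminorm
  let _ : NormedSpace ℂ (Matrix (Fin m) (Fin m) V) :=
    { norm_smul_le := fun c u => (map_smul_eq_mul (matNorm m (V := V)) c u).le }
  obtain ⟨g, hg, hgv⟩ := exists_dual_vector'' ℂ v
  refine ⟨g, fun w => ?_, hgv⟩
  refine (g.le_opNorm w).trans ?_
  calc ‖g‖ * ‖w‖ ≤ 1 * ‖w‖ := by gcongr
    _ = _ := one_mul _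

theorem sumSq_conjTranspose {n m : ℕ} (A : Matrix (Fin n) (Fin m) ℂ) : sumSq Aᴴ = sumSq A := by
  simp only [sumSq, Matrix.conjTranspose_apply, norm_star]
  exact Finset.sum_comm

/-- Complete contractions into matrix algebras determine the matrix norms of an operator space. -/
theorem exists_norming_contraction {m : ℕ} (v : Matrix (Fin m) (Fin m) V) {δ : ℝ} (hδ : 0 < δ) :
    ∃ f : V →ₗ[ℂ] (EuclideanSpace ℂ (Fin m) →L[ℂ] EuclideanSpace ℂ (Fin m)),
      CBBound f 1 ∧ matNorm m v ≤ (1 + δ * m) * matNorm m (v.map f) := by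
  obtain ⟨F, hF, hFv⟩ := exists_norming_matrix_functional v
  obtain ⟨l, hl, hFl⟩ := exists_functional_dominating F hF
  let p : Matrix (Fin m) (Fin m) ℂ →ₗ[ℝ] ℝ := l ∘ₗ LinearMap.inl ℝ _ _
  let q : Matrix (Fin m) (Fin m) ℂ →ₗ[ℝ] ℝ := l ∘ₗ LinearMap.inr ℝ _ _
  have hpq : ∀ x y, l (x, y) = p x + q y := fun x y => by
    simp only [p, q, LinearMap.comp_apply, LinearMap.inl_apply, LinearMap.inr_apply, ← map_add,
      Prod.mk_add_mk, add_zero, zero_add]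
  have hzero : ∀ (r : ℕ) (α β : Matrix (Fin m) (Fin r) ℂ),
      scalarConj α (0 : Matrix (Fin r) (Fin r) V) βᴴ = 0 := fun r α β => by
    ext; simp [scalarConj]
  -- Positivity comes from the domination inequality at `v = 0`; taking α or β zero separates the
  -- two summands.
  have hp0 : ∀ (r : ℕ) (α β : Matrix (Fin m) (Fin r) ℂ), 0 ≤ p (α * αᴴ) + q (β * βᴴ) :=
    fun r α β => by
      have := hFl r α β 0 (by simp)
      rwa [hzero, map_zero, Complex.zero_re, mul_zero, hpq] at this
  have hone : ‖(1 : Matrix (Fin m) (Fin m) ℂ)‖ ≤ 1 := by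
    rcases isEmpty_or_nonempty (Fin m) with h | h
    · rw [Subsingleton.elim (1 : Matrix (Fin m) (Fin m) ℂ) 0, norm_zero]; exact zero_le_one
    · exact CStarRing.norm_one.le
  obtain ⟨A, hAu, hA, hA1⟩ := exists_isUnit_dominating p (fun r α => by simpa using hp0 r α 0)
    ((hl _).trans (by simpa using hone)) hδ
  obtain ⟨B, hBu, hB, hB1⟩ := exists_isUnit_dominating q (fun r α => by simpa using hp0 r 0 α)
    ((hl _).trans (by simpa using hone)) hδ
  have hAd := (Matrix.isUnit_iff_isUnit_det _).1 hAu
  have hBd := (Matrix.isUnit_iff_isUnit_det _).1 hBu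
  have hBd' : IsUnit (Bᴴ).det := by rw [Matrix.det_conjTranspose]; exact hBd.star
  have key : ∀ (r : ℕ) (α : Matrix (Fin m) (Fin r) ℂ) (w : Matrix (Fin r) (Fin r) V)
      (β : Matrix (Fin r) (Fin m) ℂ),
      (F (scalarConj α w β)).re ≤ matNorm r w / 2 * (sumSq (β * Bᴴ) + sumSq (A * α)) := by
    intro r α w β
    have h1 : ∀ w : Matrix (Fin r) (Fin r) V, matNorm r w ≤ 1 →
        2 * (F (scalarConj α w β)).re ≤ sumSq (β * Bᴴ) + sumSq (A * α) := fun w hw => by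
      have h2 := hFl r α βᴴ w hw
      rw [hpq, Matrix.conjTranspose_conjTranspose] at h2
      have h3 := hA r α
      have h4 := hB r βᴴ
      have h5 := sumSq_conjTranspose (B * βᴴ)
      rw [Matrix.conjTranspose_mul, Matrix.conjTranspose_conjTranspose] at h5
      rw [Matrix.conjTranspose_conjTranspose] at h4
      linarith
    have hs : ∀ (t : ℝ), F (scalarConj α ((t : ℂ) • w) β) = t * F (scalarConj α w β) := fun t => by
      have : scalarConj α ((t : ℂ) • w) β = (t : ℂ) • scalarConj α w β := by
        ext i j
        simp only [scalarConj, Matrix.smul_apply, Matrix.of_apply, Finset.smul_sum]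
        exact Finset.sum_congr rfl fun k _ => Finset.sum_congr rfl fun k _ => smul_comm _ _ _
      rw [this, map_smul, smul_eq_mul]
    -- Normalizing by any `t` above the norm, and letting `t` decrease to it, also covers the case
    -- of norm zero.
    have h2 : ∀ t : ℝ, matNorm r w < t →
        (F (scalarConj α w β)).re ≤ t / 2 * (sumSq (β * Bᴴ) + sumSq (A * α)) := fun t ht => by
      have ht0 : 0 < t := (apply_nonneg _ _).trans_lt ht
      have h3 := h1 (((t⁻¹ : ℝ) : ℂ) • w) (by
        rw [map_smul_eq_mul, Complex.norm_real, Real.norm_of_nonneg (by positivity),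
          inv_mul_le_one₀ ht0]
        exact ht.le)
      rw [hs, Complex.re_ofReal_mul] at h3
      have h4 : t * (2 * (t⁻¹ * (F (scalarConj α w β)).re)) = 2 * (F (scalarConj α w β)).re := by
        field_simp
      have h5 := mul_le_mul_of_nonneg_left h3 ht0.le
      linarith
    refine ge_of_tendsto (x := nhdsWithin (matNorm r w) (Set.Ioi (matNorm r w)))
      (f := fun t => t / 2 * (sumSq (β * Bᴴ) + sumSq (A * α))) ?_
      (Filter.eventually_of_mem self_mem_nhdsWithin h2)
    refine Filter.Tendsto.mono_left ?_ nhdsWithin_le_nhds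
    exact Continuous.tendsto (by fun_prop) _
  -- Twisting by the inverses cancels `A` and `Bᴴ` in `key`, leaving exactly the Hilbert–Schmidt
  -- criterion with constant `matNorm r w`. Conversely, the form at `Y = A`, `X = Bᴴ` returns `F v`,
  -- the norm of `v`, and the bounds on `sumSq A` and `sumSq B` give the factor 1 + δm.
  refine ⟨mapOfFunctional F A⁻¹ (Bᴴ)⁻¹, fun r w => ?_, ?_⟩
  · rw [one_mul, matNorm_op_le_iff _ (apply_nonneg _ _)]
    intro Y X
    rw [arrayForm_mapOfFunctional]
    refine (key _ _ _ _).trans (le_of_eq ?_)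
    rw [Matrix.mul_assoc, Matrix.nonsing_inv_mul _ hBd', Matrix.mul_one, ← Matrix.mul_assoc,
      Matrix.mul_nonsing_inv _ hAd, Matrix.one_mul]
  · have h1 := (matNorm_op_le_iff (v.map (mapOfFunctional F A⁻¹ (Bᴴ)⁻¹)) (apply_nonneg _ _)).1
      le_rfl A Bᴴ
    rw [arrayForm_mapOfFunctional, Matrix.nonsing_inv_mul _ hAd, Matrix.mul_nonsing_inv _ hBd'] at h1
    have e : scalarConj (1 : Matrix (Fin m) (Fin m) ℂ) v 1 = v := by
      ext i j
      simp [scalarConj, Matrix.one_apply]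
    rw [e, hFv, Complex.ofReal_re, sumSq_conjTranspose] at h1
    have hn : 0 ≤ matNorm m (v.map (mapOfFunctional F A⁻¹ (Bᴴ)⁻¹)) := apply_nonneg _ _
    nlinarith [mul_le_mul_of_nonneg_left hA1 hn, mul_le_mul_of_nonneg_left hB1 hn]

end

/-! ### Block diagonal operators on Hilbert sums -/

section BlockDiagonal

open scoped ENNReal lp

variable {I : Type u} {E : I → Type v} [∀ s, NormedAddCommGroup (E s)]
  [∀ s, InnerProductSpace ℂ (E s)]

variable (E) in
/-- The uniformly bounded families of operators. -/
def boundedFamilies : Submodule ℂ (∀ s, E s →L[ℂ] E s) where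
  carrier := {T | ∃ C : ℝ, ∀ s, ‖T s‖ ≤ C}
  zero_mem' := ⟨0, fun s => by simp⟩
  add_mem' := by
    rintro S T ⟨C, hC⟩ ⟨D, hD⟩
    exact ⟨C + D, fun s => (norm_add_le _ _).trans (add_le_add (hC s) (hD s))⟩
  smul_mem' := by
    rintro c T ⟨C, hC⟩
    exact ⟨‖c‖ * C, fun s => by
      rw [Pi.smul_apply, norm_smul]; exact mul_le_mul_of_nonneg_left (hC s) (norm_nonneg c)⟩

variable (E) in
/-- The Hilbert space direct sum. -/
def HilbertSum : Type (max u v) := lp E 2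

instance : NormedAddCommGroup (HilbertSum E) := inferInstanceAs (NormedAddCommGroup (lp E 2))

instance : InnerProductSpace ℂ (HilbertSum E) := inferInstanceAs (InnerProductSpace ℂ (lp E 2))

instance [∀ s, CompleteSpace (E s)] : CompleteSpace (HilbertSum E) :=
  inferInstanceAs (CompleteSpace (lp E 2))

/-- The coordinates of an element of a Hilbert space direct sum. -/
def HilbertSum.coord (s : I) : HilbertSum E →ₗ[ℂ] E s where
  toFun x := x.1 s
  map_add' _ _ := rfl
  map_smul' _ _ := rfl

theorem HilbertSum.ext {x y : HilbertSum E} (h : ∀ s, x.coord s = y.coord s) : x = y :=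
  lp.ext (funext h)

theorem HilbertSum.hasSum_norm_sq (x : HilbertSum E) :
    HasSum (fun s => ‖x.coord s‖ ^ 2) (‖x‖ ^ 2) := by
  have := lp.hasSum_norm (E := E) (p := 2) (by simp) x
  simp only [ENNReal.toReal_ofNat, Real.rpow_ofNat] at this
  exact this

theorem blockDiagonal_sq_le {T : ∀ s, E s →L[ℂ] E s} {C : ℝ} (hT : ∀ s, ‖T s‖ ≤ C)
    (x : HilbertSum E) (s : I) : ‖T s (x.coord s)‖ ^ 2 ≤ C ^ 2 * ‖x.coord s‖ ^ 2 := by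
  rw [← mul_pow]
  gcongr
  exact (T s).le_of_opNorm_le (hT s) _

theorem blockDiagonal_memℓp {T : ∀ s, E s →L[ℂ] E s} (hT : ∃ C : ℝ, ∀ s, ‖T s‖ ≤ C)
    (x : HilbertSum E) : Memℓp (fun s => T s (x.coord s)) 2 := by
  obtain ⟨C, hC⟩ := hT
  refine memℓp_gen ?_
  simpa using Summable.of_nonneg_of_le (fun s => by positivity) (blockDiagonal_sq_le hC x)
    (x.hasSum_norm_sq.summable.mul_left (C ^ 2))

/-- The linear map underlying `blockDiagonal`. -/
def blockDiagonalAux (T : boundedFamilies E) : HilbertSum E →ₗ[ℂ] HilbertSum E where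
  toFun x := ⟨fun s => T.1 s (x.coord s), blockDiagonal_memℓp T.2 x⟩
  map_add' x y := HilbertSum.ext fun s => map_add (T.1 s) (x.coord s) (y.coord s)
  map_smul' c x := HilbertSum.ext fun s => map_smul (T.1 s) c (x.coord s)

theorem coord_blockDiagonalAux (T : boundedFamilies E) (x : HilbertSum E) (s : I) :
    (blockDiagonalAux T x).coord s = T.1 s (x.coord s) := rfl

theorem blockDiagonalAux_bound (T : boundedFamilies E) :
    ∃ C : ℝ, ∀ x, ‖blockDiagonalAux T x‖ ≤ C * ‖x‖ := by
  obtain ⟨C, hC⟩ := T.2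
  refine ⟨|C|, fun x => ?_⟩
  have h1 := (blockDiagonalAux T x).hasSum_norm_sq
  have h2 := x.hasSum_norm_sq.mul_left (C ^ 2)
  simp only [coord_blockDiagonalAux] at h1
  have h3 := hasSum_le (blockDiagonal_sq_le hC x) h1 h2
  refine (sq_le_sq₀ (norm_nonneg _) (by positivity)).1 ?_
  rwa [mul_pow, sq_abs]

/-- The block diagonal operator on a Hilbert space direct sum. -/
def blockDiagonal : boundedFamilies E →ₗ[ℂ] (HilbertSum E →L[ℂ] HilbertSum E) where
  toFun T := LinearMap.mkContinuousOfExistsBound (blockDiagonalAux T) (blockDiagonalAux_bound T)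
  map_add' _ _ := ContinuousLinearMap.ext fun _ => HilbertSum.ext fun _ => rfl
  map_smul' _ _ := ContinuousLinearMap.ext fun _ => HilbertSum.ext fun _ => rfl

/-- Squared norms in the sum are sums over `s`, and on the `s`-th coordinates of an r-tuple the
operator acts as the matrix of `s`-th blocks. The estimate therefore holds term by term. -/
theorem matNorm_blockDiagonal_le {r : ℕ} (T : Matrix (Fin r) (Fin r) (boundedFamilies E)) {C : ℝ}
    (hC : 0 ≤ C) (h : ∀ s, matNorm r (Matrix.of fun p q => (T p q).1 s) ≤ C) :
    matNorm r (T.map (blockDiagonal (E := E))) ≤ C := by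
  change ‖matToOp (HilbertSum E) r (T.map blockDiagonal)‖ ≤ C
  refine ContinuousLinearMap.opNorm_le_bound _ hC fun x => ?_
  refine (sq_le_sq₀ (norm_nonneg _) (by positivity)).1 ?_
  rw [mul_pow, PiLp.norm_sq_eq_of_L2, PiLp.norm_sq_eq_of_L2]
  have h1 := hasSum_sum (s := Finset.univ) fun p _ =>
    HilbertSum.hasSum_norm_sq (matToOp (HilbertSum E) r (T.map blockDiagonal) x p)
  have h2 := (hasSum_sum (s := Finset.univ) fun p _ =>
    HilbertSum.hasSum_norm_sq (x p)).mul_left (C ^ 2)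
  refine hasSum_le (fun s => ?_) h1 h2
  let y : PiLp 2 (fun _ : Fin r => E s) := WithLp.toLp 2 fun q => (x q).coord s
  have h1 : ‖matToOp _ r (Matrix.of fun p q => (T p q).1 s) y‖ ≤ C * ‖y‖ :=
    ContinuousLinearMap.le_of_opNorm_le _ (h s) _
  have h2 := pow_le_pow_left₀ (norm_nonneg _) h1 2
  rw [mul_pow, PiLp.norm_sq_eq_of_L2, PiLp.norm_sq_eq_of_L2] at h2
  refine le_trans (le_of_eq (Finset.sum_congr rfl fun p _ => ?_)) h2
  rw [matToOp_apply, matToOp_apply, map_sum]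
  rfl

/-- Compression of operators by a pair of contractions is completely contractive. -/
theorem CBBound_compression {H : Type u} [NormedAddCommGroup H] [InnerProductSpace ℂ H]
    {K : Type v} [NormedAddCommGroup K] [InnerProductSpace ℂ K] (A : K →L[ℂ] H) (B : H →L[ℂ] K)
    (hA : ‖A‖ ≤ 1) (hB : ‖B‖ ≤ 1) (σ : (H →L[ℂ] H) →ₗ[ℂ] (K →L[ℂ] K))
    (hσ : ∀ T x, σ T x = B (T (A x))) : CBBound σ 1 := by
  intro r b
  rw [one_mul]
  change ‖matToOp _ r (b.map σ)‖ ≤ ‖matToOp _ r b‖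
  refine ContinuousLinearMap.opNorm_le_bound _ (norm_nonneg (matToOp H r b)) fun x => ?_
  let y : PiLp 2 (fun _ : Fin r => H) := WithLp.toLp 2 fun q => A (x q)
  have hA' : ∀ z, ‖A z‖ ≤ ‖z‖ := fun z => by
    simpa using (A.le_opNorm z).trans (mul_le_mul_of_nonneg_right hA (norm_nonneg z))
  have hB' : ∀ z, ‖B z‖ ≤ ‖z‖ := fun z => by
    simpa using (B.le_opNorm z).trans (mul_le_mul_of_nonneg_right hB (norm_nonneg z))
  have hy : ‖y‖ ≤ ‖x‖ := by
    refine (sq_le_sq₀ (norm_nonneg _) (norm_nonneg _)).1 ?_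
    rw [PiLp.norm_sq_eq_of_L2, PiLp.norm_sq_eq_of_L2]
    exact Finset.sum_le_sum fun q _ => pow_le_pow_left₀ (norm_nonneg _) (hA' _) 2
  have h1 : ‖matToOp _ r (b.map σ) x‖ ≤ ‖matToOp _ r b y‖ := by
    refine (sq_le_sq₀ (norm_nonneg _) (norm_nonneg _)).1 ?_
    rw [PiLp.norm_sq_eq_of_L2, PiLp.norm_sq_eq_of_L2]
    refine Finset.sum_le_sum fun p _ => pow_le_pow_left₀ (norm_nonneg _) ?_ 2
    have e : matToOp _ r (b.map σ) x p = B (matToOp _ r b y p) := by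
      rw [matToOp_apply, matToOp_apply, map_sum]
      exact Finset.sum_congr rfl fun q _ => hσ _ _
    rw [e]
    exact hB' _
  exact h1.trans ((ContinuousLinearMap.le_opNorm _ _).trans
    (mul_le_mul_of_nonneg_left hy (norm_nonneg _)))

end BlockDiagonal

/-! ### The minimal norm of block diagonal tensors -/

section MinNormBlock

open scoped ENNReal

variable {I : Type u} (n : I → ℕ)

/-- The Hilbert space direct sum of the spaces `ℂ^{n s}`. -/
abbrev BlockHilbert : Type u := HilbertSum (fun s => EuclideanSpace ℂ (Fin (n s)))

/-- The bounded families of `n s × n s` matrices. -/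
abbrev BlockFamily : Type u := boundedFamilies (fun s => EuclideanSpace ℂ (Fin (n s)))

variable {n}

/-- A block of a bounded family. -/
def BlockFamily.block (s : I) : BlockFamily n →ₗ[ℂ]
    (EuclideanSpace ℂ (Fin (n s)) →L[ℂ] EuclideanSpace ℂ (Fin (n s))) where
  toFun T := T.1 s
  map_add' _ _ := rfl
  map_smul' _ _ := rfl

/-- The block diagonal operator given by a family of matrices. -/
def BlockFamily.toOp : BlockFamily n →ₗ[ℂ] (BlockHilbert n →L[ℂ] BlockHilbert n) :=
  blockDiagonal (E := fun s => EuclideanSpace ℂ (Fin (n s)))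

theorem BlockFamily.matNorm_toOp_le {r : ℕ} (T : Matrix (Fin r) (Fin r) (BlockFamily n)) {C : ℝ}
    (hC : 0 ≤ C) (h : ∀ s, matNorm r (T.map (BlockFamily.block s)) ≤ C) :
    matNorm r (T.map BlockFamily.toOp) ≤ C :=
  matNorm_blockDiagonal_le (E := fun s => EuclideanSpace ℂ (Fin (n s))) T hC h

variable (n)

open Classical in
/-- The coordinate subspaces of a Hilbert space direct sum. -/
def coordIncl (s : I) : EuclideanSpace ℂ (Fin (n s)) →L[ℂ] BlockHilbert n :=
  LinearMap.mkContinuous (F := BlockHilbert n)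
    (lp.lsingle (𝕜 := ℂ) (E := fun s => EuclideanSpace ℂ (Fin (n s))) 2 s) 1
    fun x => by
      rw [one_mul]
      exact (lp.norm_single (E := fun s => EuclideanSpace ℂ (Fin (n s))) (p := 2) (by simp) s x).le

/-- The coordinate projections of a Hilbert space direct sum. -/
def coordProj (s : I) : BlockHilbert n →L[ℂ] EuclideanSpace ℂ (Fin (n s)) :=
  LinearMap.mkContinuous
    { toFun := fun x : BlockHilbert n => x.1 s
      map_add' := fun _ _ => rfl
      map_smul' := fun _ _ => rfl } 1 fun x => by
      rw [one_mul]
      exact lp.norm_apply_le_norm (E := fun s => EuclideanSpace ℂ (Fin (n s))) (p := 2) (by simp) x s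

theorem coordProj_toOp_coordIncl (s : I) (T : BlockFamily n) (x : EuclideanSpace ℂ (Fin (n s))) :
    coordProj n s (T.toOp (coordIncl n s x)) = T.block s x := by
  classical
  change T.1 s ((lp.single (E := fun s => EuclideanSpace ℂ (Fin (n s))) 2 s x).1 s) = T.1 s x
  rw [lp.single_apply_self]

/-- The compression of operators on a Hilbert space direct sum to one of the summands. -/
def blockCompression (s : I) : CCToMat (BlockHilbert n →L[ℂ] BlockHilbert n) (n s) :=
  ⟨{ toFun := fun T => coordProj n s ∘L T ∘L coordIncl n s
     map_add' := fun S T => by ext; simp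
     map_smul' := fun c T => by ext; simp },
    CBBound_compression (coordIncl n s) (coordProj n s)
      (LinearMap.mkContinuous_norm_le _ zero_le_one _)
      (LinearMap.mkContinuous_norm_le _ zero_le_one _) _ fun T x => rfl⟩

theorem blockCompression_entry (s : I) (T : BlockFamily n) (p q : Fin (n s)) :
    (blockCompression n s).entry p q T.toOp = opMatrix (T.block s) p q := by
  have : (blockCompression n s).1 T.toOp = T.block s := by
    ext1 x
    exact coordProj_toOp_coordIncl n s T x
  rw [← this]; rfl

variable {V : Type w} [NormedAddCommGroup V] [NormedSpace ℂ V] [OperatorSpace V]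

/-- The minimal norm slices the operator leg by contractions σ. Testing the slice with a complete
contraction f : V → M_m makes the two legs symmetric: f ⊗ σ can be computed by applying f first, and
the result is a matrix of block diagonal operators, whose norm is controlled block by block. -/
theorem minSeminorm_blockFamily_le (t : V ⊗[ℂ] BlockFamily n) {C : ℝ} (hC : 0 ≤ C)
    (h : ∀ s, matNorm (n s)
      ((blockCompression n s).slice V (BlockFamily.toOp.lTensor V t)) ≤ C) :
    minSeminorm V _ (BlockFamily.toOp.lTensor V t) ≤ C := by
  obtain ⟨S, rfl⟩ := TensorProduct.exists_finset t
  rw [minSeminorm_apply]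
  refine Real.iSup_le (fun σ => ?_) hC
  obtain ⟨m, σ⟩ := σ
  simp only [map_sum, LinearMap.lTensor_tmul, CCToMat.slice_tmul] at h ⊢
  set z : Matrix (Fin m) (Fin m) V :=
    ∑ i ∈ S, Matrix.of fun p q => σ.entry p q i.2.toOp • i.1 with hz
  -- Complete contractions into `M_m` norm `z` up to the factor 1 + δm, which disappears as δ → 0.
  suffices key : ∀ f : V →ₗ[ℂ] (EuclideanSpace ℂ (Fin m) →L[ℂ] EuclideanSpace ℂ (Fin m)),
      CBBound f 1 → matNorm m (z.map f) ≤ C by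
    have h1 : ∀ δ : ℝ, 0 < δ → matNorm m z ≤ (1 + δ * m) * C := fun δ hδ => by
      obtain ⟨f, hf, hfz⟩ := exists_norming_contraction z hδ
      exact hfz.trans (mul_le_mul_of_nonneg_left (key f hf) (by positivity))
    refine ge_of_tendsto (x := nhdsWithin 0 (Set.Ioi 0)) (f := fun δ : ℝ => (1 + δ * m) * C) ?_
      (Filter.eventually_of_mem self_mem_nhdsWithin h1)
    have : Filter.Tendsto (fun δ : ℝ => (1 + δ * m) * C) (nhds 0) (nhds ((1 + 0 * m) * C)) :=
      Continuous.tendsto (by fun_prop) _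
    rw [zero_mul, add_zero, one_mul] at this
    exact this.mono_left nhdsWithin_le_nhds
  intro f hf
  -- The image of the tensor under f ⊗ id, as a matrix of bounded families. A first shuffle compares
  -- it with `z.map f`, and a second one, block by block, with `f` applied to the blocks over `V`.
  let Y : Matrix (Fin m) (Fin m) (BlockFamily n) :=
    Matrix.of fun p q => ∑ i ∈ S, opMatrix (f i.1) p q • i.2
  have h1 : matNorm m (z.map f) ≤ matNorm m ((Y.map BlockFamily.toOp).map σ.1) := by
    refine matNorm_le_of_shuffle _ _ fun p q i j => ?_
    simp only [hz, Y, opMatrix, Matrix.map_apply, Matrix.sum_apply, Matrix.of_apply, map_sum,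
      map_smul, Matrix.smul_apply, smul_eq_mul]
    exact Finset.sum_congr rfl fun k _ => mul_comm _ _
  refine h1.trans ((σ.2 _ _).trans ?_)
  rw [one_mul]
  refine BlockFamily.matNorm_toOp_le Y hC fun s => ?_
  refine le_trans (matNorm_le_of_shuffle _ ((∑ i ∈ S, Matrix.of fun p q =>
    (blockCompression n s).entry p q i.2.toOp • i.1).map f) fun p q i j => ?_)
    ((hf _ _).trans ((one_mul _).le.trans (h s)))
  simp only [blockCompression_entry, Y]
  simp only [opMatrix, Matrix.map_apply, Matrix.sum_apply, Matrix.of_apply, map_sum,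
      map_smul, Matrix.smul_apply, smul_eq_mul]
  exact Finset.sum_congr rfl fun k _ => mul_comm _ _

/-- A bounded family of matrices over a finite-dimensional subspace is given by an element of the
algebraic tensor product. -/
theorem exists_blockFamily_slice_eq (E : Submodule ℂ V) [FiniteDimensional ℂ E]
    (y : ∀ s, Matrix (Fin (n s)) (Fin (n s)) V) (hyE : ∀ s i j, y s i j ∈ E) {C : ℝ}
    (hy : ∀ s, matNorm (n s) (y s) ≤ C) :
    ∃ t : V ⊗[ℂ] BlockFamily n,
      ∀ s, (blockCompression n s).slice V (BlockFamily.toOp.lTensor V t) = y s := by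
  obtain ⟨P, hP⟩ := Submodule.ClosedComplemented.of_finiteDimensional E
  let b := Module.finBasis ℂ E
  -- Composing with a bounded projection onto `E` makes the coordinates bounded functionals on `V`.
  -- They are then completely bounded, so the coordinate families are bounded uniformly in the
  -- block.
  let c : Fin (Module.finrank ℂ E) → V →L[ℂ] ℂ := fun i =>
    (LinearMap.toContinuousLinearMap (b.coord i)) ∘L P
  have hc : ∀ i s, ‖Matrix.toEuclideanCLM (n := Fin (n s)) (𝕜 := ℂ) ((y s).map (c i))‖
      ≤ ‖c i‖ * C := fun i s => by
    rw [Matrix.l2_opNorm_toEuclideanCLM]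
    exact (norm_functional_matrix_le (c i) (y s)).trans
      (mul_le_mul_of_nonneg_left (hy s) (norm_nonneg _))
  let T : Fin (Module.finrank ℂ E) → BlockFamily n := fun i => ⟨_, _, hc i⟩
  refine ⟨∑ i, (b i : V) ⊗ₜ T i, fun s => ?_⟩
  simp only [map_sum, LinearMap.lTensor_tmul, CCToMat.slice_tmul]
  ext p q
  have e1 : ∀ i, (blockCompression n s).entry p q (T i).toOp = c i (y s p q) :=
    fun i => by
      rw [blockCompression_entry]
      change (Matrix.toEuclideanCLM (n := Fin (n s)) (𝕜 := ℂ)).symm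
        (Matrix.toEuclideanCLM (n := Fin (n s)) (𝕜 := ℂ) ((y s).map (c i))) p q = _
      rw [StarAlgEquiv.symm_apply_apply]; rfl
  simp only [Matrix.sum_apply, Matrix.of_apply, e1]
  have e2 := congrArg (Subtype.val) (b.sum_repr (P (y s p q)))
  rw [hP ⟨y s p q, hyE s p q⟩] at e2
  simp only [Submodule.coe_sum, Submodule.coe_smul] at e2
  refine Eq.trans (Finset.sum_congr rfl fun i _ => ?_) e2
  simp [c, hP ⟨y s p q, hyE s p q⟩]

end MinNormBlock

/-! ### Completely bounded maps and their action on tensor products -/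

section CompletelyBounded

variable {V : Type u} [NormedAddCommGroup V] [NormedSpace ℂ V] [OperatorSpace V]
variable {W : Type v} [NormedAddCommGroup W] [NormedSpace ℂ W] [OperatorSpace W]
variable {X : Type w} [NormedAddCommGroup X] [NormedSpace ℂ X] [OperatorSpace X]

theorem CBBound.comp {φ : V →ₗ[ℂ] W} {ψ : W →ₗ[ℂ] X} {C D : ℝ} (hD : 0 ≤ D) (hψ : CBBound ψ D)
    (hφ : CBBound φ C) : CBBound (ψ ∘ₗ φ) (D * C) := fun n x => by
  have := (hψ n (x.map φ)).trans (mul_le_mul_of_nonneg_left (hφ n x) hD)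
  rwa [← mul_assoc] at this

/-- Composition of completely bounded maps. -/
def cbComp (ψ : CB W X) (φ : CB V W) : CB V X :=
  ⟨(ψ : W →ₗ[ℂ] X) ∘ₗ (φ : V →ₗ[ℂ] W), by
    obtain ⟨D, hD, hψ⟩ := ψ.2
    obtain ⟨C, hC, hφ⟩ := φ.2
    exact ⟨D * C, mul_nonneg hD hC, hψ.comp hD hφ⟩⟩

theorem IsFiniteRank.cbComp {ψ : CB W X} (hψ : IsFiniteRank ψ) (φ : CB V W) :
    IsFiniteRank (_root_.cbComp ψ φ) := by
  unfold IsFiniteRank at hψ ⊢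
  exact Submodule.finiteDimensional_of_le (LinearMap.range_comp_le_range (φ : V →ₗ[ℂ] W)
    (ψ : W →ₗ[ℂ] X))

theorem cbNorm_le {φ : CB V W} {C : ℝ} (hC : 0 ≤ C) (h : CBBound (φ : V →ₗ[ℂ] W) C) :
    cbNorm φ ≤ C := csInf_le ⟨0, fun _ h => h.1⟩ ⟨hC, h⟩

theorem exists_CBBound_of_cbNorm_lt {φ : CB V W} {ε : ℝ} (h : cbNorm φ < ε) :
    ∃ C, 0 ≤ C ∧ C < ε ∧ CBBound (φ : V →ₗ[ℂ] W) C := by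
  obtain ⟨C, hC, hCε⟩ := exists_lt_of_csInf_lt (φ.2.imp fun _ h => h) h
  exact ⟨C, hC.1, hCε, hC.2⟩

theorem eq_zero_of_matNorm_eq_zero {n : ℕ} {x : Matrix (Fin n) (Fin n) V} (h : matNorm n x = 0) :
    x = 0 := by
  ext i j
  exact norm_le_zero_iff.1 ((norm_entry_le_matNorm x i j).trans h.le)

theorem CBBound_of_unitBall {φ : V →ₗ[ℂ] W} {C : ℝ}
    (h : ∀ (n : ℕ) (x : Matrix (Fin n) (Fin n) V), matNorm n x ≤ 1 → matNorm n (x.map φ) ≤ C) :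
    CBBound φ C := fun n x => by
  rcases (apply_nonneg (matNorm (V := V) n) x).eq_or_lt with h0 | h0
  · have hx := eq_zero_of_matNorm_eq_zero h0.symm
    have e : (0 : Matrix (Fin n) (Fin n) V).map φ = 0 := by ext; simp
    rw [hx, e, map_zero, map_zero, mul_zero]
  · set t : ℝ := matNorm n x
    have e : (((t⁻¹ : ℝ) : ℂ) • x).map φ = ((t⁻¹ : ℝ) : ℂ) • x.map φ := by ext; simp
    have ht : ‖((t⁻¹ : ℝ) : ℂ)‖ = t⁻¹ := by
      rw [Complex.norm_real, Real.norm_of_nonneg (by positivity)]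
    have h1 := h n (((t⁻¹ : ℝ) : ℂ) • x) (by
      rw [map_smul_eq_mul, ht]; exact (inv_mul_cancel₀ h0.ne').le)
    rwa [e, map_smul_eq_mul, ht, inv_mul_le_iff₀ h0, mul_comm] at h1

end CompletelyBounded

section Tensor

theorem CCToMat.slice_rTensor {X : Type u} [NormedAddCommGroup X] [NormedSpace ℂ X]
    {X' : Type v} [NormedAddCommGroup X'] [NormedSpace ℂ X']
    {Y : Type w} [NormedAddCommGroup Y] [NormedSpace ℂ Y]
    [OperatorSpace Y] {m : ℕ} (σ : CCToMat Y m) (φ : X →ₗ[ℂ] X') (u : X ⊗[ℂ] Y) :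
    σ.slice X' (φ.rTensor Y u) = (σ.slice X u).map φ := by
  induction u with
  | zero => ext; simp
  | tmul x y => ext; simp [CCToMat.slice_tmul]
  | add u v hu hv => rw [map_add, map_add, hu, hv]; ext; simp

variable {X : Type u} [NormedAddCommGroup X] [NormedSpace ℂ X] [OperatorSpace X]
variable {X' : Type v} [NormedAddCommGroup X'] [NormedSpace ℂ X'] [OperatorSpace X']
variable (Y : Type w) [NormedAddCommGroup Y] [NormedSpace ℂ Y] [OperatorSpace Y]

theorem matNorm_slice_le {Y : Type w} [NormedAddCommGroup Y] [NormedSpace ℂ Y]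
    [OperatorSpace Y] {m : ℕ} (σ : CCToMat Y m) (u : X ⊗[ℂ] Y) :
    matNorm m (σ.slice X u) ≤ minSeminorm X Y u := by
  rw [minSeminorm_apply]
  exact le_ciSup (Seminorm.bddAbove_range_iff.1 (minSeminorm_bddAbove X Y) u)
    (⟨m, σ⟩ : Σ m : ℕ, CCToMat Y m)

theorem tensorId_coe (φ : CB X X') (u : MinTensor X Y) :
    tensorId Y φ (u : CompletedMinTensor X Y)
      = ((algTensorId Y φ u : MinTensor X' Y) : CompletedMinTensor X' Y) :=
  ContinuousLinearMap.completion_apply_coe _ _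

theorem tensorId_id (a : CompletedMinTensor X Y) : tensorId Y (CB.id X) a = a := by
  induction a using UniformSpace.Completion.induction_on with
  | hp => exact isClosed_eq (ContinuousLinearMap.continuous _) continuous_id
  | ih u =>
    rw [tensorId_coe]
    congr 1
    exact LinearMap.rTensor_id_apply Y X u

theorem norm_tensorId_le (φ : CB X X') {C : ℝ} (hC : 0 ≤ C) (h : CBBound (φ : X →ₗ[ℂ] X') C)
    (a : CompletedMinTensor X Y) : ‖tensorId Y φ a‖ ≤ C * ‖a‖ := by
  induction a using UniformSpace.Completion.induction_on with
  | hp => exact isClosed_le (ContinuousLinearMap.continuous _).norm (by fun_prop)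
  | ih u =>
    rw [tensorId_coe, UniformSpace.Completion.norm_coe, UniformSpace.Completion.norm_coe]
    exact minSeminorm_map_le Y _ hC h u

end Tensor

/-! ### From the approximation property to completely compact maps -/

section

variable {V : Type u} [NormedAddCommGroup V] [NormedSpace ℂ V] [OperatorSpace V]

/-- Approximation of the identity at a single element of a tensor product. -/
theorem HasStrongOperatorApproximationProperty.exists_finiteRank
    (h : HasStrongOperatorApproximationProperty V) (H : Type u) [NormedAddCommGroup H]
    [InnerProductSpace ℂ H] [CompleteSpace H] (a : CompletedMinTensor V (H →L[ℂ] H)) {ε : ℝ}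
    (hε : 0 < ε) : ∃ α : CB V V, IsFiniteRank α ∧ ‖tensorId (H →L[ℂ] H) α a - a‖ < ε := by
  let _ := stronglyStablePointNormTopology V V
  have hle : stronglyStablePointNormTopology V V ≤ TopologicalSpace.induced
      (fun φ : CB V V => tensorId (H →L[ℂ] H) φ a) inferInstance := by
    unfold stronglyStablePointNormTopology
    exact iInf_le_of_le H (iInf_le_of_le _ (iInf_le_of_le _ (iInf_le_of_le _ (iInf_le _ a))))
  have hcont : Continuous fun φ : CB V V => tensorId (H →L[ℂ] H) φ a :=
    continuous_iff_le_induced.2 hle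
  have hopen : IsOpen {φ : CB V V | ‖tensorId (H →L[ℂ] H) φ a - a‖ < ε} :=
    isOpen_lt (by fun_prop) continuous_const
  obtain ⟨α, h1, h2⟩ := mem_closure_iff.1 h _ hopen (by
    change ‖tensorId (H →L[ℂ] H) (CB.id V) a - a‖ < ε
    rwa [tensorId_id, sub_self, norm_zero])
  exact ⟨α, h2, h1⟩

theorem HasStrongOperatorApproximationProperty.approximation
    (h : HasStrongOperatorApproximationProperty V) {W : Type u} [NormedAddCommGroup W]
    [NormedSpace ℂ W] [OperatorSpace W] (φ : CB W V) (hφ : IsCompletelyCompactMap φ) {ε : ℝ}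
    (hε : 0 < ε) : ∃ ψ : CB W V, IsFiniteRank ψ ∧ cbNorm (φ - ψ) < ε := by
  -- One block for each matrix in each unit ball, so that a single tensor carries all of φ. With `W`
  -- in the universe of `V`, the resulting Hilbert space is admissible in the topology.
  let I : Type u := Σ n : ℕ, {x : Matrix (Fin n) (Fin n) W // matNorm n x ≤ 1}
  let n : I → ℕ := fun s => s.1
  let y : ∀ s : I, Matrix (Fin (n s)) (Fin (n s)) V := fun s => s.2.1.map (φ : W →ₗ[ℂ] V)
  have hy : ∀ s, y s ∈ MatrixSet.closure
      (MatrixSet.image (φ : W →ₗ[ℂ] V) (matrixUnitBall W)) (n s) := fun s δ hδ =>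
    ⟨y s, ⟨s.2.1, s.2.2, rfl⟩, by rwa [sub_self, map_zero]⟩
  obtain ⟨-, ⟨C, hC⟩, hfin⟩ := hφ
  have hC' : ∀ s, matNorm (n s) (y s) ≤ C := fun s => hC _ _ (hy s)
  choose E hE hEy using fun k : ℕ => hfin ((1 / 2 : ℝ) ^ k) (by positivity)
  choose z hz hzy using fun (k : ℕ) (s : I) => hEy k (n s) (y s) (hy s)
  have hzC : ∀ k s, matNorm (n s) (z k s) ≤ C + 1 := fun k s => by
    have e : z k s = y s - (y s - z k s) := by abel
    have h1 := map_sub_le_add (matNorm (n s)) (y s) (y s - z k s)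
    rw [← e] at h1
    have h2 : (1 / 2 : ℝ) ^ k ≤ 1 := pow_le_one₀ (by norm_num) (by norm_num)
    linarith [hC' s, hzy k s]
  choose t ht using fun k => exists_blockFamily_slice_eq n (E k) (z k) (hz k) (hzC k)
  let Y := BlockHilbert n →L[ℂ] BlockHilbert n
  let U : ℕ → MinTensor V Y := fun k => BlockFamily.toOp.lTensor V (t k)
  have hU : ∀ k s, (blockCompression n s).slice V (U k : V ⊗[ℂ] Y) = z k s := ht
  -- Both approximants are close to the same `y s` on every block, and the block estimate makes this
  -- a bound in the minimal norm.
  have hdist : ∀ k l, dist (U k) (U l) ≤ (1 / 2 : ℝ) ^ k + (1 / 2 : ℝ) ^ l := fun k l => by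
    rw [dist_eq_norm]
    change minSeminorm V Y
      (BlockFamily.toOp.lTensor V (t k) - BlockFamily.toOp.lTensor V (t l)) ≤ _
    rw [← map_sub]
    refine minSeminorm_blockFamily_le n _ (by positivity) fun s => ?_
    rw [map_sub, map_sub, ht, ht]
    have e : z k s - z l s = (y s - z l s) - (y s - z k s) := by abel
    have h1 := map_sub_le_add (matNorm (n s)) (y s - z l s) (y s - z k s)
    rw [← e] at h1
    linarith [hzy k s, hzy l s]
  have hpow : Filter.Tendsto (fun k : ℕ => (1 / 2 : ℝ) ^ k) Filter.atTop (nhds 0) :=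
    tendsto_pow_atTop_nhds_zero_of_lt_one (by norm_num) (by norm_num)
  have hcau : CauchySeq fun k => (U k : CompletedMinTensor V Y) := by
    refine cauchySeq_of_le_tendsto_0 (fun N : ℕ => (1 / 2 : ℝ) ^ N + (1 / 2 : ℝ) ^ N)
      (fun k l N hk hl => ?_) (by simpa using hpow.add hpow)
    rw [UniformSpace.Completion.dist_eq]
    exact (hdist k l).trans (add_le_add
      (pow_le_pow_of_le_one (by norm_num) (by norm_num) hk)
      (pow_le_pow_of_le_one (by norm_num) (by norm_num) hl))
  obtain ⟨a, ha⟩ := cauchySeq_tendsto_of_complete hcau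
  obtain ⟨α, hα, hαa⟩ := h.exists_finiteRank (BlockHilbert n) a (half_pos hε)
  obtain ⟨D, hD, hαD⟩ : ∃ D : ℝ, 0 ≤ D ∧ CBBound ((α - CB.id V : CB V V) : V →ₗ[ℂ] V) D :=
    (α - CB.id V).2
  -- Slices are available only on algebraic tensors, so each `U k` is sliced to block `s`. The
  -- discrepancy between `z k s` and `y s` costs at most `D * (1 / 2) ^ k`, which vanishes in the
  -- limit.
  have hbound : ∀ s, matNorm (n s) ((y s).map ((α - CB.id V : CB V V) : V →ₗ[ℂ] V)) ≤ ε / 2 := by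
    intro s
    have h1 : ∀ k, matNorm (n s) ((y s).map ((α - CB.id V : CB V V) : V →ₗ[ℂ] V))
        ≤ ‖tensorId Y α (U k) - (U k : CompletedMinTensor V Y)‖ + D * (1 / 2 : ℝ) ^ k := by
      intro k
      have e : (y s).map ((α - CB.id V : CB V V) : V →ₗ[ℂ] V)
          = (z k s).map ((α - CB.id V : CB V V) : V →ₗ[ℂ] V)
            + (y s - z k s).map ((α - CB.id V : CB V V) : V →ₗ[ℂ] V) := by
        ext i j
        simp only [Matrix.map_apply, Matrix.add_apply, Matrix.sub_apply, map_sub]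
        abel
      rw [e]
      refine (map_add_le_add _ _ _).trans (add_le_add ?_ ((hαD _ _).trans
        (mul_le_mul_of_nonneg_left (hzy k s).le hD)))
      rw [← hU, ← CCToMat.slice_rTensor]
      refine (matNorm_slice_le _ _).trans (le_of_eq ?_)
      rw [tensorId_coe, ← UniformSpace.Completion.coe_sub, UniformSpace.Completion.norm_coe,
        MinTensor.norm_def]
      congr 1
      change LinearMap.rTensor Y ((α : V →ₗ[ℂ] V) - LinearMap.id) _ = _
      rw [LinearMap.rTensor_sub, LinearMap.rTensor_id]
      rfl
    have h2 : Filter.Tendsto (fun k => ‖tensorId Y α (U k) - (U k : CompletedMinTensor V Y)‖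
        + D * (1 / 2 : ℝ) ^ k) Filter.atTop (nhds (‖tensorId Y α a - a‖ + D * 0)) :=
      ((((ContinuousLinearMap.continuous _).tendsto a).comp ha).sub ha).norm.add
        (hpow.const_mul D)
    have h3 := ge_of_tendsto' h2 h1
    rw [mul_zero, add_zero] at h3
    exact h3.trans hαa.le
  refine ⟨cbComp α φ, hα.cbComp φ, lt_of_le_of_lt (cbNorm_le (half_pos hε).le ?_) (half_lt_self hε)⟩
  refine CBBound_of_unitBall fun m x hx => le_trans (le_of_eq ?_) (hbound ⟨m, x, hx⟩)
  rw [← map_neg_eq_map]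
  congr 1
  ext i j
  change -((φ : W →ₗ[ℂ] V) (x i j) - (α : V →ₗ[ℂ] V) ((φ : W →ₗ[ℂ] V) (x i j)))
    = (α : V →ₗ[ℂ] V) ((φ : W →ₗ[ℂ] V) (x i j)) - (φ : W →ₗ[ℂ] V) (x i j)
  abel

end

/-! ### Subspaces, quotients and ℓ^∞ sums as operator spaces -/

theorem matDirectSum_map {V : Type u} [AddCommGroup V] {W : Type v} [AddCommGroup W]
    {F : Type*} [FunLike F V W] [AddMonoidHomClass F V W] (f : F) {n m : ℕ}
    (v : Matrix (Fin n) (Fin n) V) (w : Matrix (Fin m) (Fin m) V) :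
    (matDirectSum v w).map f = matDirectSum (v.map f) (w.map f) := by
  unfold matDirectSum
  ext i j
  rcases hi : finSumFinEquiv.symm i with a | a <;> rcases hj : finSumFinEquiv.symm j with b | b <;>
    simp [hi, hj]

theorem scalarConj_map {V : Type u} [AddCommGroup V] [Module ℂ V] {W : Type v} [AddCommGroup W]
    [Module ℂ W] (f : V →ₗ[ℂ] W) {n m : ℕ} (α : Matrix (Fin n) (Fin m) ℂ)
    (v : Matrix (Fin m) (Fin m) V) (β : Matrix (Fin m) (Fin n) ℂ) :
    (scalarConj α v β).map f = scalarConj α (v.map f) β := by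
  ext i j
  simp [scalarConj]

section Submodule

variable {V : Type u} [NormedAddCommGroup V] [NormedSpace ℂ V] [OperatorSpace V]

/-- The operator space structure of a subspace. -/
instance instOperatorSpaceSubmodule (E : Submodule ℂ V) : OperatorSpace E where
  matNorm n := (matNorm (V := V) n).comp E.subtype.mapMatrix
  matNorm_one x := OperatorSpace.matNorm_one (x : V)
  matNorm_directSum {n m} v w := by
    simp only [Seminorm.comp_apply, LinearMap.mapMatrix_apply]
    rw [matDirectSum_map, OperatorSpace.matNorm_directSum]
  matNorm_scalarConj_le {n m} α v β := by
    simp only [Seminorm.comp_apply, LinearMap.mapMatrix_apply]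
    rw [scalarConj_map]
    exact OperatorSpace.matNorm_scalarConj_le _ _ _

theorem matNorm_submodule (E : Submodule ℂ V) {n : ℕ} (x : Matrix (Fin n) (Fin n) E) :
    matNorm n x = matNorm n (x.map E.subtype) := rfl

theorem matNorm_single_le {n : ℕ} (i j : Fin n) (x : V) :
    matNorm n (Matrix.single i j x) ≤ ‖x‖ := by
  let R : Fin n → Matrix (Fin 1) (Fin n) ℂ := fun a => Matrix.of fun _ k => if k = a then 1 else 0
  have hR : ∀ a, ‖R a‖ ≤ 1 := fun a => by
    have h := l2_opNorm_row_sq (fun k : Fin n => if k = a then (1 : ℂ) else 0)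
    have e : ∑ k : Fin n, ‖(if k = a then (1 : ℂ) else 0)‖ ^ 2 = 1 := by
      rw [Finset.sum_eq_single a] <;> simp +contextual
    rw [e] at h
    exact (sq_le_one_iff₀ (norm_nonneg _)).1 h
  have h := OperatorSpace.matNorm_scalarConj_le (R i)ᴴ (Matrix.of fun _ _ => x) (R j)
  have e : scalarConj (R i)ᴴ (Matrix.of fun _ _ => x) (R j) = Matrix.single i j x := by
    ext p q
    by_cases hp : p = i <;> by_cases hq : q = j <;>
      simp [scalarConj, R, hp, hq, Matrix.single_apply, eq_comm, ite_and]
    grind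
  rw [e, OperatorSpace.matNorm_one, Matrix.l2_opNorm_conjTranspose] at h
  calc _ ≤ _ := h
    _ ≤ 1 * ‖x‖ * 1 := by gcongr <;> exact hR _
    _ = _ := by ring

theorem matNorm_le_sum {n : ℕ} (x : Matrix (Fin n) (Fin n) V) :
    matNorm n x ≤ ∑ i, ∑ j, ‖x i j‖ := by
  conv_lhs => rw [Matrix.matrix_eq_sum_single x]
  have h : ∀ f : Fin n → Matrix (Fin n) (Fin n) V, matNorm n (∑ i, f i) ≤ ∑ i, matNorm n (f i) :=
    fun f => Finset.le_sum_of_subadditive _ (map_zero _).le (map_add_le_add _) _ _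
  exact (h _).trans (Finset.sum_le_sum fun i _ => (h _).trans
    (Finset.sum_le_sum fun j _ => matNorm_single_le i j _))

/-- Injectivity makes the selection matrix `R` a coisometry, and the submatrix is the compression by
`R`. -/
theorem matNorm_submatrix_le {n m : ℕ} (x : Matrix (Fin n) (Fin n) V) {f : Fin m → Fin n}
    (hf : Function.Injective f) : matNorm m (x.submatrix f f) ≤ matNorm n x := by
  let R : Matrix (Fin m) (Fin n) ℂ := Matrix.of fun a k => if k = f a then 1 else 0
  have hR1 : R * Rᴴ = 1 := by
    ext a b
    simp [R, Matrix.mul_apply, Matrix.one_apply, hf.eq_iff, eq_comm]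
  have hone : ‖(1 : Matrix (Fin m) (Fin m) ℂ)‖ ≤ 1 := by
    rcases isEmpty_or_nonempty (Fin m) with h | h
    · rw [Subsingleton.elim (1 : Matrix (Fin m) (Fin m) ℂ) 0, norm_zero]; exact zero_le_one
    · exact CStarRing.norm_one.le
  have hR : ‖R‖ ≤ 1 := by
    have h := Matrix.l2_opNorm_conjTranspose_mul_self Rᴴ
    rw [Matrix.conjTranspose_conjTranspose, hR1, Matrix.l2_opNorm_conjTranspose] at h
    nlinarith [norm_nonneg R]
  have h := OperatorSpace.matNorm_scalarConj_le R x Rᴴ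
  have e : scalarConj R x Rᴴ = x.submatrix f f := by
    ext a b
    simp [scalarConj, R]
  rw [e, Matrix.l2_opNorm_conjTranspose] at h
  calc _ ≤ _ := h
    _ ≤ 1 * matNorm n x * 1 := by gcongr
    _ = _ := by ring

end Submodule

section Quotient

variable {X : Type u} [NormedAddCommGroup X] [NormedSpace ℂ X] [OperatorSpace X]
variable (N : Submodule ℂ X)

/-- The quotient matrix norms. -/
def quotientMatNorm (n : ℕ) (y : Matrix (Fin n) (Fin n) (X ⧸ N)) : ℝ :=
  sInf {r : ℝ | ∃ x : Matrix (Fin n) (Fin n) X, x.map N.mkQ = y ∧ matNorm n x = r}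

variable {N}

theorem quotientMatNorm_le {n : ℕ} {y : Matrix (Fin n) (Fin n) (X ⧸ N)}
    (x : Matrix (Fin n) (Fin n) X) (hx : x.map N.mkQ = y) : quotientMatNorm N n y ≤ matNorm n x :=
  csInf_le ⟨0, by rintro _ ⟨x, -, rfl⟩; exact apply_nonneg _ _⟩ ⟨x, hx, rfl⟩

theorem exists_lift_matNorm_lt {n : ℕ} (y : Matrix (Fin n) (Fin n) (X ⧸ N)) {ε : ℝ} (hε : 0 < ε) :
    ∃ x : Matrix (Fin n) (Fin n) X, x.map N.mkQ = y ∧ matNorm n x < quotientMatNorm N n y + ε := by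
  have hne : {r : ℝ | ∃ x : Matrix (Fin n) (Fin n) X, x.map N.mkQ = y ∧ matNorm n x = r}.Nonempty := by
    choose x hx using fun i j => N.mkQ_surjective (y i j)
    exact ⟨_, Matrix.of x, by ext i j; exact hx i j, rfl⟩
  obtain ⟨_, ⟨x, hx, rfl⟩, hlt⟩ := exists_lt_of_csInf_lt hne
    (lt_add_of_pos_right (quotientMatNorm N n y) hε)
  exact ⟨x, hx, hlt⟩

theorem quotientMatNorm_nonneg {n : ℕ} (y : Matrix (Fin n) (Fin n) (X ⧸ N)) :
    0 ≤ quotientMatNorm N n y :=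
  Real.sInf_nonneg (by rintro _ ⟨x, -, rfl⟩; exact apply_nonneg _ _)

variable (N)

/-- The quotient matrix norms, as seminorms. -/
def quotientMatSeminorm (n : ℕ) : Seminorm ℂ (Matrix (Fin n) (Fin n) (X ⧸ N)) :=
  Seminorm.ofSMulLE (quotientMatNorm N n)
    (le_antisymm ((quotientMatNorm_le 0 (by ext; simp)).trans (map_zero _).le)
      (quotientMatNorm_nonneg _))
    (fun y z => by
      refine le_of_forall_pos_le_add fun ε hε => ?_
      obtain ⟨x, hx, hx'⟩ := exists_lift_matNorm_lt y (half_pos hε)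
      obtain ⟨t, ht, ht'⟩ := exists_lift_matNorm_lt z (half_pos hε)
      have h1 := quotientMatNorm_le (N := N) (y := y + z) (x + t) (by
        rw [← hx, ← ht]; ext; simp)
      have h2 := map_add_le_add (matNorm n) x t
      linarith)
    (fun c y => by
      refine le_of_forall_pos_le_add fun ε hε => ?_
      have hδ : 0 < ε / (‖c‖ + 1) := by positivity
      obtain ⟨x, hx, hx'⟩ := exists_lift_matNorm_lt y hδ
      have h1 := quotientMatNorm_le (N := N) (y := c • y) (c • x) (by rw [← hx]; ext; simp)
      rw [map_smul_eq_mul] at h1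
      have h2 : ‖c‖ * (ε / (‖c‖ + 1)) ≤ ε := by
        rw [mul_div_assoc', div_le_iff₀ (by positivity)]
        nlinarith [norm_nonneg c]
      nlinarith [norm_nonneg c, mul_le_mul_of_nonneg_left hx'.le (norm_nonneg c)])

/-- The operator space structure of a quotient by a closed subspace. -/
instance instOperatorSpaceQuotient [hN : IsClosed (N : Set X)] : OperatorSpace (X ⧸ N) where
  matNorm := quotientMatSeminorm N
  matNorm_one y := by
    change quotientMatNorm N 1 _ = _
    apply le_antisymm
    · refine le_of_forall_pos_le_add fun ε hε => ?_
      obtain ⟨x, hx, hx'⟩ := Submodule.Quotient.norm_mk_lt y hε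
      refine (quotientMatNorm_le (Matrix.of fun _ _ => x) (by ext; exact hx)).trans ?_
      rw [OperatorSpace.matNorm_one]
      exact hx'.le
    · refine le_of_forall_pos_le_add fun ε hε => ?_
      obtain ⟨x, hx, hx'⟩ := exists_lift_matNorm_lt (Matrix.of fun (_ _ : Fin 1) => y) hε
      have h1 : N.mkQ (x 0 0) = y := congrFun (congrFun hx 0) 0
      rw [← h1] at hx' ⊢
      exact (Submodule.Quotient.norm_mk_le N (x 0 0)).trans
        ((norm_entry_le_matNorm x 0 0).trans hx'.le)
  matNorm_directSum {n m} v w := by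
    change quotientMatNorm N (n + m) _ = max (quotientMatNorm N n v) (quotientMatNorm N m w)
    apply le_antisymm
    · refine le_of_forall_pos_le_add fun ε hε => ?_
      obtain ⟨x, hx, hx'⟩ := exists_lift_matNorm_lt v hε
      obtain ⟨t, ht, ht'⟩ := exists_lift_matNorm_lt w hε
      refine (quotientMatNorm_le (matDirectSum x t) (by rw [matDirectSum_map, hx, ht])).trans ?_
      rw [OperatorSpace.matNorm_directSum]
      exact max_le (hx'.le.trans (by gcongr; exact le_max_left _ _))
        (ht'.le.trans (by gcongr; exact le_max_right _ _))
    -- A lift of `v ⊕ w` need not be block diagonal, but its diagonal corners lift `v` and `w` and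
    -- have no larger norm.
    · refine le_of_forall_pos_le_add fun ε hε => ?_
      obtain ⟨x, hx, hx'⟩ := exists_lift_matNorm_lt (matDirectSum v w) hε
      let x₁ : Matrix (Fin n) (Fin n) X := x.submatrix (Fin.castAdd m) (Fin.castAdd m)
      let x₂ : Matrix (Fin m) (Fin m) X := x.submatrix (Fin.natAdd n) (Fin.natAdd n)
      have hx₁ : x₁.map N.mkQ = v := by
        ext i j
        have := congrFun (congrFun hx (Fin.castAdd m i)) (Fin.castAdd m j)
        simpa [matDirectSum, x₁, x₂] using this
      have hx₂ : x₂.map N.mkQ = w := by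
        ext i j
        have := congrFun (congrFun hx (Fin.natAdd n i)) (Fin.natAdd n j)
        simpa [matDirectSum, x₁, x₂] using this
      refine le_trans (max_le ((quotientMatNorm_le x₁ hx₁).trans ?_)
        ((quotientMatNorm_le x₂ hx₂).trans ?_)) hx'.le
      · exact matNorm_submatrix_le x (Fin.castAdd_injective n m)
      · exact matNorm_submatrix_le x (Fin.natAdd_injective m n)
  matNorm_scalarConj_le {n m} α v β := by
    change quotientMatNorm N n _ ≤ ‖α‖ * quotientMatNorm N m v * ‖β‖
    refine le_of_forall_pos_le_add fun ε hε => ?_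
    have hδ : 0 < ε / (‖α‖ * ‖β‖ + 1) := by positivity
    obtain ⟨x, hx, hx'⟩ := exists_lift_matNorm_lt v hδ
    refine (quotientMatNorm_le (scalarConj α x β) (by rw [scalarConj_map, hx])).trans ?_
    refine (OperatorSpace.matNorm_scalarConj_le α x β).trans ?_
    have h2 : ‖α‖ * ‖β‖ * (ε / (‖α‖ * ‖β‖ + 1)) ≤ ε := by
      rw [mul_div_assoc', div_le_iff₀ (by positivity)]
      nlinarith
    have h3 : 0 ≤ ‖α‖ * ‖β‖ := by positivity
    nlinarith [mul_le_mul_of_nonneg_left hx'.le h3]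

theorem CBBound_mkQ [IsClosed (N : Set X)] : CBBound N.mkQ 1 := fun n x => by
  rw [one_mul]
  exact quotientMatNorm_le x rfl

theorem CBBound_liftQ [IsClosed (N : Set X)] {V : Type v} [NormedAddCommGroup V] [NormedSpace ℂ V]
    [OperatorSpace V] (f : X →ₗ[ℂ] V) (hf : N ≤ LinearMap.ker f) {C : ℝ} (hC : 0 ≤ C)
    (h : CBBound f C) : CBBound (N.liftQ f hf) C := fun n y => by
  change _ ≤ C * quotientMatNorm N n y
  refine le_of_forall_pos_le_add fun ε hε => ?_
  have hδ : 0 < ε / (C + 1) := by positivity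
  obtain ⟨x, rfl, hx'⟩ := exists_lift_matNorm_lt y hδ
  have e : (x.map N.mkQ).map (N.liftQ f hf) = x.map f := by ext; simp
  rw [e]
  refine (h n x).trans ?_
  have h2 : C * (ε / (C + 1)) ≤ ε := by
    rw [mul_div_assoc', div_le_iff₀ (by positivity)]
    nlinarith
  nlinarith [mul_le_mul_of_nonneg_left hx'.le hC]

end Quotient

section LinftySum

open scoped ENNReal

variable {ι : Type u} {E : ι → Type v} [∀ k, NormedAddCommGroup (E k)] [∀ k, NormedSpace ℂ (E k)]

variable (E) in
/-- The `ℓ^∞` direct sum. -/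
def LinftySum : Type (max u v) := lp E ∞

instance : NormedAddCommGroup (LinftySum E) := inferInstanceAs (NormedAddCommGroup (lp E ∞))

instance : NormedSpace ℂ (LinftySum E) := inferInstanceAs (NormedSpace ℂ (lp E ∞))

instance [∀ k, CompleteSpace (E k)] : CompleteSpace (LinftySum E) :=
  inferInstanceAs (CompleteSpace (lp E ∞))

/-- The coordinates on an `ℓ^∞` direct sum. -/
def LinftySum.coord (k : ι) : LinftySum E →ₗ[ℂ] E k where
  toFun x := x.1 k
  map_add' _ _ := rfl
  map_smul' _ _ := rfl

theorem LinftySum.norm_coord_le (x : LinftySum E) (k : ι) : ‖x.coord k‖ ≤ ‖x‖ :=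
  lp.norm_apply_le_norm (E := E) (p := ∞) (by simp) x k

theorem LinftySum.norm_le {x : LinftySum E} {C : ℝ} (hC : 0 ≤ C) (h : ∀ k, ‖x.coord k‖ ≤ C) :
    ‖x‖ ≤ C := lp.norm_le_of_forall_le (E := E) hC h

open Classical in
/-- The inclusion of a summand. -/
def LinftySum.incl (k : ι) : E k →ₗ[ℂ] LinftySum E := lp.lsingle (𝕜 := ℂ) (E := E) ∞ k

theorem LinftySum.coord_incl_self (k : ι) (x : E k) : (LinftySum.incl k x).coord k = x := by
  classical exact lp.single_apply_self (E := E) ∞ k x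

theorem LinftySum.coord_incl_ne {k l : ι} (h : l ≠ k) (x : E k) :
    (LinftySum.incl k x).coord l = 0 := by
  classical exact lp.single_apply_ne (E := E) ∞ k x h

variable [∀ k, OperatorSpace (E k)]

theorem LinftySum.bddAbove (n : ℕ) : BddAbove (Set.range fun k : ι =>
    ((matNorm n).comp (LinftySum.coord (E := E) k).mapMatrix :
      Seminorm ℂ (Matrix (Fin n) (Fin n) (LinftySum E)))) := by
  rw [Seminorm.bddAbove_range_iff]
  intro x
  refine ⟨∑ i, ∑ j, ‖x i j‖, ?_⟩
  rintro _ ⟨k, rfl⟩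
  exact (matNorm_le_sum _).trans (Finset.sum_le_sum fun i _ => Finset.sum_le_sum fun j _ =>
    LinftySum.norm_coord_le _ _)

/-- The matrix norms of an `ℓ^∞` direct sum. -/
def LinftySum.seminorm (n : ℕ) : Seminorm ℂ (Matrix (Fin n) (Fin n) (LinftySum E)) :=
  ⨆ k, (matNorm n).comp (LinftySum.coord (E := E) k).mapMatrix

theorem LinftySum.le_seminorm {n : ℕ} (x : Matrix (Fin n) (Fin n) (LinftySum E)) (k : ι) :
    matNorm n (x.map (LinftySum.coord k)) ≤ LinftySum.seminorm n x := by
  rw [LinftySum.seminorm, Seminorm.iSup_apply (LinftySum.bddAbove n)]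
  exact le_ciSup (Seminorm.bddAbove_range_iff.1 (LinftySum.bddAbove n) x) k

theorem LinftySum.seminorm_le {n : ℕ} {x : Matrix (Fin n) (Fin n) (LinftySum E)} {C : ℝ}
    (hC : 0 ≤ C) (h : ∀ k, matNorm n (x.map (LinftySum.coord k)) ≤ C) :
    LinftySum.seminorm n x ≤ C := by
  rw [LinftySum.seminorm, Seminorm.iSup_apply (LinftySum.bddAbove n)]
  exact Real.iSup_le h hC

/-- The operator space structure of an `ℓ^∞` direct sum. -/
instance instOperatorSpaceLinftySum : OperatorSpace (LinftySum E) where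
  matNorm := LinftySum.seminorm
  matNorm_one x := by
    apply le_antisymm
    · refine LinftySum.seminorm_le (norm_nonneg _) fun k => ?_
      exact (OperatorSpace.matNorm_one (x.coord k)).le.trans (LinftySum.norm_coord_le x k)
    · refine LinftySum.norm_le (apply_nonneg _ _) fun k => ?_
      exact (OperatorSpace.matNorm_one (x.coord k)).ge.trans
        (LinftySum.le_seminorm (Matrix.of fun (_ _ : Fin 1) => x) k)
  matNorm_directSum {n m} v w := by
    apply le_antisymm
    · refine LinftySum.seminorm_le (le_max_of_le_left (apply_nonneg _ _)) fun k => ?_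
      rw [matDirectSum_map, OperatorSpace.matNorm_directSum]
      exact max_le_max (LinftySum.le_seminorm v k) (LinftySum.le_seminorm w k)
    · have h : ∀ k, max (matNorm n (v.map (LinftySum.coord k)))
          (matNorm m (w.map (LinftySum.coord k))) ≤ LinftySum.seminorm (n + m) (matDirectSum v w) :=
        fun k => by
          rw [← OperatorSpace.matNorm_directSum, ← matDirectSum_map]
          exact LinftySum.le_seminorm _ k
      exact max_le
        (LinftySum.seminorm_le (apply_nonneg _ _) fun k => (le_max_left _ _).trans (h k))
        (LinftySum.seminorm_le (apply_nonneg _ _) fun k => (le_max_right _ _).trans (h k))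
  matNorm_scalarConj_le {n m} α v β := by
    refine LinftySum.seminorm_le (by positivity) fun k => ?_
    rw [scalarConj_map]
    refine (OperatorSpace.matNorm_scalarConj_le _ _ _).trans ?_
    gcongr
    exact LinftySum.le_seminorm v k

theorem LinftySum.CBBound_incl (k : ι) : CBBound (LinftySum.incl (E := E) k) 1 := fun n x => by
  rw [one_mul]
  refine LinftySum.seminorm_le (apply_nonneg _ _) fun l => ?_
  rcases eq_or_ne l k with rfl | h
  · have e : (x.map (LinftySum.incl l)).map (LinftySum.coord (E := E) l) = x := by
      ext i j; exact LinftySum.coord_incl_self l (x i j)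
    rw [e]
  · have e : (x.map (LinftySum.incl k)).map (LinftySum.coord (E := E) l) = 0 := by
      ext i j; exact LinftySum.coord_incl_ne h (x i j)
    rw [e, map_zero]
    exact apply_nonneg _ _

end LinftySum

/-! ### Finite rank maps as sums of rank one maps -/

section RankOne

variable {V : Type u} [NormedAddCommGroup V] [NormedSpace ℂ V] [OperatorSpace V]
variable {W : Type v} [NormedAddCommGroup W] [NormedSpace ℂ W] [OperatorSpace W]

theorem CBBound.norm_le {φ : V →ₗ[ℂ] W} {C : ℝ} (h : CBBound φ C) (x : V) : ‖φ x‖ ≤ C * ‖x‖ := by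
  have h1 := h 1 (Matrix.of fun _ _ => x)
  rw [OperatorSpace.matNorm_one] at h1
  exact (OperatorSpace.matNorm_one (φ x)).ge.trans h1

/-- A completely bounded map is continuous. -/
def cbToContinuous (φ : CB V W) : V →L[ℂ] W :=
  LinearMap.mkContinuousOfExistsBound (φ : V →ₗ[ℂ] W) (φ.2.imp fun _ h => h.2.norm_le)

theorem cbToContinuous_apply (φ : CB V W) (x : V) :
    cbToContinuous φ x = (φ : V →ₗ[ℂ] W) x := rfl

/-- The rank one map `x ↦ f(x) w`. -/
def rankOne (f : V →L[ℂ] ℂ) (w : W) : CB V W :=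
  ⟨(f : V →ₗ[ℂ] ℂ).smulRight w, ‖f‖ * ‖w‖, by positivity, CBBound_smulRight f w⟩

theorem rankOne_apply (f : V →L[ℂ] ℂ) (w : W) (x : V) :
    (rankOne f w : V →ₗ[ℂ] W) x = f x • w := rfl

theorem isFiniteRank_zero : IsFiniteRank (0 : CB V W) := by
  unfold IsFiniteRank
  rw [show ((0 : CB V W) : V →ₗ[ℂ] W) = 0 from rfl, LinearMap.range_zero]
  infer_instance

theorem IsFiniteRank.add {φ ψ : CB V W} (hφ : IsFiniteRank φ) (hψ : IsFiniteRank ψ) :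
    IsFiniteRank (φ + ψ) := by
  unfold IsFiniteRank at *
  refine Submodule.finiteDimensional_of_le
    (S₂ := LinearMap.range (φ : V →ₗ[ℂ] W) ⊔ LinearMap.range (ψ : V →ₗ[ℂ] W)) ?_
  rintro _ ⟨x, rfl⟩
  exact Submodule.add_mem_sup ⟨x, rfl⟩ ⟨x, rfl⟩

theorem IsFiniteRank.smul {φ : CB V W} (hφ : IsFiniteRank φ) (c : ℂ) : IsFiniteRank (c • φ) := by
  unfold IsFiniteRank at *
  refine Submodule.finiteDimensional_of_le (S₂ := LinearMap.range (φ : V →ₗ[ℂ] W)) ?_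
  rintro _ ⟨x, rfl⟩
  exact ⟨c • x, map_smul _ _ _⟩

theorem isFiniteRank_rankOne (f : V →L[ℂ] ℂ) (w : W) : IsFiniteRank (rankOne f w) := by
  unfold IsFiniteRank
  refine Submodule.finiteDimensional_of_le (S₂ := Submodule.span ℂ {w}) ?_
  rintro _ ⟨x, rfl⟩
  exact Submodule.smul_mem _ _ (Submodule.mem_span_singleton_self w)

/-- The coefficient functionals are the coordinates of φ in a basis of its range. A bounded
projection onto the range presents them as composites of continuous maps. -/
theorem IsFiniteRank.exists_eq_sum_rankOne {φ : CB V W} (hφ : IsFiniteRank φ) :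
    ∃ (n : ℕ) (f : Fin n → V →L[ℂ] ℂ) (w : Fin n → W), φ = ∑ k, rankOne (f k) (w k) := by
  have : FiniteDimensional ℂ (LinearMap.range (φ : V →ₗ[ℂ] W)) := hφ
  let R := LinearMap.range (φ : V →ₗ[ℂ] W)
  let b := Module.finBasis ℂ R
  obtain ⟨P, hP⟩ := Submodule.ClosedComplemented.of_finiteDimensional R
  refine ⟨_, fun k => (LinearMap.toContinuousLinearMap (b.coord k)) ∘L P ∘L cbToContinuous φ,
    fun k => b k, ?_⟩
  apply Subtype.ext
  ext x
  have e1 : P ((φ : V →ₗ[ℂ] W) x) = ⟨(φ : V →ₗ[ℂ] W) x, x, rfl⟩ := hP ⟨_, x, rfl⟩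
  have e2 := congrArg Subtype.val (b.sum_repr ⟨(φ : V →ₗ[ℂ] W) x, x, rfl⟩)
  simp only [Submodule.coe_sum, Submodule.coe_smul] at e2
  rw [Submodule.coe_sum, LinearMap.sum_apply]
  refine e2.symm.trans (Finset.sum_congr rfl fun k _ => ?_)
  rw [rankOne_apply]
  simp [cbToContinuous_apply, e1]

end RankOne

/-! ### Slicing completed tensors, and approximation along injective maps -/

section Tensor

variable {X : Type u} [NormedAddCommGroup X] [NormedSpace ℂ X] [OperatorSpace X]
variable {X' : Type v} [NormedAddCommGroup X'] [NormedSpace ℂ X'] [OperatorSpace X']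
variable (Y : Type w) [NormedAddCommGroup Y] [NormedSpace ℂ Y] [OperatorSpace Y]

theorem tensorId_add (φ ψ : CB X X') (a : CompletedMinTensor X Y) :
    tensorId Y (φ + ψ) a = tensorId Y φ a + tensorId Y ψ a := by
  induction a using UniformSpace.Completion.induction_on with
  | hp =>
    exact isClosed_eq (tensorId Y (φ + ψ)).continuous
      ((tensorId Y φ).continuous.add (tensorId Y ψ).continuous)
  | ih u =>
    rw [tensorId_coe, tensorId_coe, tensorId_coe, ← UniformSpace.Completion.coe_add]
    congr 1
    exact LinearMap.congr_fun (LinearMap.rTensor_add Y (φ : X →ₗ[ℂ] X') (ψ : X →ₗ[ℂ] X')) u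

theorem tensorId_smul (c : ℂ) (φ : CB X X') (a : CompletedMinTensor X Y) :
    tensorId Y (c • φ) a = c • tensorId Y φ a := by
  induction a using UniformSpace.Completion.induction_on with
  | hp =>
    exact isClosed_eq (tensorId Y (c • φ)).continuous
      ((tensorId Y φ).continuous.const_smul c)
  | ih u =>
    rw [tensorId_coe, tensorId_coe, ← UniformSpace.Completion.coe_smul]
    congr 1
    exact LinearMap.congr_fun (LinearMap.rTensor_smul Y c (φ : X →ₗ[ℂ] X')) u

/-- `tensorId` as a linear map in its operator argument. -/
def tensorIdEval (a : CompletedMinTensor X Y) : CB X X' →ₗ[ℂ] CompletedMinTensor X' Y where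
  toFun φ := tensorId Y φ a
  map_add' φ ψ := tensorId_add Y φ ψ a
  map_smul' c φ := tensorId_smul Y c φ a

theorem tensorId_cbComp {X'' : Type*} [NormedAddCommGroup X''] [NormedSpace ℂ X'']
    [OperatorSpace X''] (ψ : CB X' X'') (φ : CB X X') (a : CompletedMinTensor X Y) :
    tensorId Y (cbComp ψ φ) a = tensorId Y ψ (tensorId Y φ a) := by
  induction a using UniformSpace.Completion.induction_on with
  | hp =>
    exact isClosed_eq (tensorId Y (cbComp ψ φ)).continuous
      ((tensorId Y ψ).continuous.comp (tensorId Y φ).continuous)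
  | ih u =>
    rw [tensorId_coe, tensorId_coe, tensorId_coe]
    congr 1
    exact LinearMap.rTensor_comp_apply Y (ψ : X' →ₗ[ℂ] X'') (φ : X →ₗ[ℂ] X') u

variable (X) in
/-- The canonical map from the algebraic to the completed tensor product. -/
def toCompleted : X ⊗[ℂ] Y →ₗ[ℂ] CompletedMinTensor X Y :=
  ((UniformSpace.Completion.toComplL :
    MinTensor X Y →L[ℂ] CompletedMinTensor X Y) : MinTensor X Y →ₗ[ℂ] CompletedMinTensor X Y)

/-- Slicing an element of a completed tensor product by a functional of rank one maps. -/
theorem exists_slice_rankOne [CompleteSpace X] (L : CompletedMinTensor X' Y →L[ℂ] ℂ) (v : X')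
    (b : CompletedMinTensor X Y) :
    ∃ x : X, ∀ f : X →L[ℂ] ℂ, f x = L (tensorId Y (rankOne f v) b) := by
  let K : X' ⊗[ℂ] Y →ₗ[ℂ] ℂ := (L : CompletedMinTensor X' Y →ₗ[ℂ] ℂ) ∘ₗ toCompleted X' Y
  -- The slice map x ⊗ y ↦ L(v ⊗ y) x.
  let T₀ : X ⊗[ℂ] Y →ₗ[ℂ] X :=
    TensorProduct.lift ((LinearMap.lsmul ℂ X).flip.compl₂ (K ∘ₗ TensorProduct.mk ℂ X' Y v))
  have hT₀ : ∀ (f : X →L[ℂ] ℂ) (u : MinTensor X Y),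
      f (T₀ u) = L (tensorId Y (rankOne f v) (u : CompletedMinTensor X Y)) := by
    intro f u
    rw [tensorId_coe]
    change ((f : X →ₗ[ℂ] ℂ) ∘ₗ T₀) u
      = (K ∘ₗ ((rankOne f v : CB X X') : X →ₗ[ℂ] X').rTensor Y) u
    refine LinearMap.congr_fun (TensorProduct.ext' fun x y => ?_) u
    change f (K (v ⊗ₜ y) • x) = K ((f x • v) ⊗ₜ y)
    rw [map_smul, ← TensorProduct.smul_tmul', map_smul, smul_eq_mul, smul_eq_mul, mul_comm]
  -- Boundedness is tested against functionals on `X`. As `X` is complete, the slice of a completed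
  -- tensor is then a point of `X` itself and not merely of its bidual.
  have hbound : ∀ u : MinTensor X Y, ‖T₀ u‖ ≤ ‖L‖ * ‖v‖ * ‖u‖ := fun u => by
    refine NormedSpace.norm_le_dual_bound ℂ _ (by positivity) fun f => ?_
    rw [hT₀]
    have h1 := norm_tensorId_le Y (rankOne f v) (by positivity) (CBBound_smulRight f v)
      (u : CompletedMinTensor X Y)
    rw [UniformSpace.Completion.norm_coe] at h1
    calc _ ≤ ‖L‖ * _ := L.le_opNorm _
      _ ≤ ‖L‖ * (‖f‖ * ‖v‖ * ‖u‖) := by gcongr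
      _ = _ := by ring
  let T : MinTensor X Y →L[ℂ] X :=
    LinearMap.mkContinuous (E := MinTensor X Y) T₀ (‖L‖ * ‖v‖) hbound
  let T' : CompletedMinTensor X Y →L[ℂ] X := T.extend UniformSpace.Completion.toComplL
  have hT' : ∀ u : MinTensor X Y, T' (u : CompletedMinTensor X Y) = T₀ u :=
    T.extend_eq UniformSpace.Completion.denseRange_coe
      (UniformSpace.Completion.isUniformInducing_coe _)
  refine ⟨T' b, fun f => ?_⟩
  induction b using UniformSpace.Completion.induction_on with
  | hp =>
    exact isClosed_eq (f.continuous.comp T'.continuous)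
      (L.continuous.comp (tensorId Y (rankOne f v)).continuous)
  | ih u => rw [hT', hT₀]

end Tensor

theorem exists_dual_vanishing_on_closed {P : Type*} [NormedAddCommGroup P] [NormedSpace ℂ P]
    (S : Submodule ℂ P) (hS : IsClosed (S : Set P)) {x : P} (hx : x ∉ S) :
    ∃ L : P →L[ℂ] ℂ, (∀ s ∈ S, L s = 0) ∧ L x ≠ 0 := by
  have hx0 : S.mkQ x ≠ 0 := fun h => hx ((Submodule.Quotient.mk_eq_zero S).1 h)
  obtain ⟨g, -, hg⟩ := exists_dual_vector ℂ (S.mkQ x) (norm_ne_zero_iff.2 hx0)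
  let π : P →L[ℂ] P ⧸ S := LinearMap.mkContinuous S.mkQ 1 fun y => by
    rw [one_mul]; exact Submodule.Quotient.norm_mk_le S y
  refine ⟨g ∘L π, fun s hs => ?_, ?_⟩
  · have : S.mkQ s = 0 := (Submodule.Quotient.mk_eq_zero S).2 hs
    change g (S.mkQ s) = 0
    rw [this, map_zero]
  · change g (S.mkQ x) ≠ 0
    rw [hg]
    exact Complex.ofReal_ne_zero.2 (norm_ne_zero_iff.2 hx0)

section

variable {V : Type u} [NormedAddCommGroup V] [NormedSpace ℂ V] [OperatorSpace V]
variable {W : Type v} [NormedAddCommGroup W] [NormedSpace ℂ W] [OperatorSpace W]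
variable {ι : Type} [Fintype ι] {Y : ι → Type w} [∀ i, NormedAddCommGroup (Y i)]
  [∀ i, NormedSpace ℂ (Y i)] [∀ i, OperatorSpace (Y i)]

/-- Along an injective map, functionals can be approximated by restrictions of functionals, in the
strongly stable sense. -/
theorem tensorId_rankOne_mem [CompleteSpace W] (j : CB W V)
    (hj : Function.Injective (j : W →ₗ[ℂ] V)) (b : ∀ i, CompletedMinTensor W (Y i))
    (S : Submodule ℂ (∀ i, CompletedMinTensor V (Y i)))
    (hS : IsClosed (S : Set (∀ i, CompletedMinTensor V (Y i)))) (v : V)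
    (h : ∀ g : V →L[ℂ] ℂ, (fun i => tensorId (Y i) (rankOne g v) (tensorId (Y i) j (b i))) ∈ S)
    (f : W →L[ℂ] ℂ) : (fun i => tensorId (Y i) (rankOne f v) (b i)) ∈ S := by
  classical
  -- If the tuple were outside `S`, some `L` would vanish on `S` but not on it. As a function of
  -- `f`, the value of `L` on the tuple is evaluation at the point `∑ i, x i` of `W`; the
  -- functionals `g ∘ j` annihilate that point, so `j` sends it to zero.
  by_contra hx
  obtain ⟨L, hLS, hLx⟩ := exists_dual_vanishing_on_closed S hS hx
  choose x hx using fun i => exists_slice_rankOne (Y i)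
    (L ∘L ContinuousLinearMap.single ℂ (fun i => CompletedMinTensor V (Y i)) i) v (b i)
  have hsum : ∀ f : W →L[ℂ] ℂ,
      f (∑ i, x i) = L (fun i => tensorId (Y i) (rankOne f v) (b i)) := fun f => by
    rw [map_sum]
    simp only [hx]
    change ∑ i, L (Pi.single i (tensorId (Y i) (rankOne f v) (b i))) = _
    rw [← map_sum]
    congr 1
    exact Finset.univ_sum_single _
  have h0 : (j : W →ₗ[ℂ] V) (∑ i, x i) = 0 := by
    refine (SeparatingDual.eq_zero_iff_forall_dual_eq_zero (R := ℂ) _).2 fun g => ?_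
    have h1 := hsum (g ∘L cbToContinuous j)
    have h2 : ∀ i, tensorId (Y i) (rankOne (g ∘L cbToContinuous j) v : CB W V) (b i)
        = tensorId (Y i) (rankOne g v) (tensorId (Y i) j (b i)) := fun i => by
      rw [← tensorId_cbComp]; rfl
    simp only [h2] at h1
    rw [hLS _ (h g)] at h1
    exact h1
  have hz : ∑ i, x i = 0 := hj (by rw [h0, map_zero])
  rw [← hsum, hz, map_zero] at hLx
  exact hLx rfl

/-- If an injective map is a limit of finite rank maps, then elements in the range of the induced
map of tensor products can be approximated by finite rank maps. -/
theorem mem_closure_of_injective_factorization [CompleteSpace W] (j : CB W V)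
    (hj : Function.Injective (j : W →ₗ[ℂ] V)) (b : ∀ i, CompletedMinTensor W (Y i))
    (happ : ∀ ε : ℝ, 0 < ε → ∃ ψ : CB W V, IsFiniteRank ψ ∧ cbNorm (j - ψ) < ε) :
    (fun i => tensorId (Y i) j (b i)) ∈
      closure {z : ∀ i, CompletedMinTensor V (Y i) | ∃ φ : CB V V, IsFiniteRank φ ∧
        z = fun i => tensorId (Y i) φ (tensorId (Y i) j (b i))} := by
  let S₀ : Submodule ℂ (∀ i, CompletedMinTensor V (Y i)) :=
    { carrier := {z | ∃ φ : CB V V, IsFiniteRank φ ∧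
        z = fun i => tensorId (Y i) φ (tensorId (Y i) j (b i))}
      zero_mem' := ⟨0, isFiniteRank_zero, funext fun i =>
        (map_zero (tensorIdEval (X' := V) (Y i) (tensorId (Y i) j (b i)))).symm⟩
      add_mem' := by
        rintro _ _ ⟨φ, hφ, rfl⟩ ⟨ψ, hψ, rfl⟩
        exact ⟨φ + ψ, hφ.add hψ, funext fun i => (tensorId_add (Y i) φ ψ _).symm⟩
      smul_mem' := by
        rintro c _ ⟨φ, hφ, rfl⟩
        exact ⟨c • φ, hφ.smul c, funext fun i => (tensorId_smul (Y i) c φ _).symm⟩ }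
  let S := S₀.topologicalClosure
  have hS : IsClosed (S : Set (∀ i, CompletedMinTensor V (Y i))) :=
    S₀.isClosed_topologicalClosure
  change _ ∈ S
  have hone : ∀ (f : W →L[ℂ] ℂ) (v : V),
      (fun i => tensorId (Y i) (rankOne f v) (b i)) ∈ S := fun f v =>
    tensorId_rankOne_mem j hj b S hS v (fun g => S₀.le_topologicalClosure
      ⟨rankOne g v, isFiniteRank_rankOne g v, rfl⟩) f
  have hfin : ∀ ψ : CB W V, IsFiniteRank ψ → (fun i => tensorId (Y i) ψ (b i)) ∈ S := by
    intro ψ hψ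
    obtain ⟨n, f, v, rfl⟩ := hψ.exists_eq_sum_rankOne
    have e : (fun i => tensorId (Y i) (∑ k, rankOne (f k) (v k) : CB W V) (b i))
        = ∑ k, fun i => tensorId (Y i) (rankOne (f k) (v k)) (b i) := by
      ext i
      rw [Finset.sum_apply]
      exact map_sum (tensorIdEval (X' := V) (Y i) (b i)) _ _
    rw [e]
    exact S.sum_mem fun k _ => hone _ _
  have hcl : (fun i => tensorId (Y i) j (b i)) ∈ closure (S : Set _) := by
    rw [Metric.mem_closure_iff]
    intro ε hε
    have hB : 0 < ε / (‖b‖ + 1) := by positivity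
    obtain ⟨ψ, hψ, hjψ⟩ := happ _ hB
    obtain ⟨C, hC, hCε, hbd⟩ := exists_CBBound_of_cbNorm_lt hjψ
    refine ⟨_, hfin ψ hψ, ?_⟩
    rw [dist_pi_lt_iff hε]
    intro i
    have e : tensorId (Y i) j (b i) - tensorId (Y i) ψ (b i) = tensorId (Y i) (j - ψ) (b i) :=
      (map_sub (tensorIdEval (X' := V) (Y i) (b i)) j ψ).symm
    rw [dist_eq_norm, e]
    refine (norm_tensorId_le (Y i) (j - ψ) hC hbd (b i)).trans_lt ?_
    calc C * ‖b i‖ ≤ C * ‖b‖ := by gcongr; exact norm_le_pi_norm b i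
      _ ≤ C * (‖b‖ + 1) := by gcongr; linarith
      _ < ε / (‖b‖ + 1) * (‖b‖ + 1) := by gcongr
      _ = ε := by field_simp
  rwa [hS.closure_eq] at hcl

end

/-! ### A criterion for complete compactness, and the weighted sum map -/

section Criterion

variable {V : Type u} [NormedAddCommGroup V] [NormedSpace ℂ V] [OperatorSpace V]
variable {W : Type v} [NormedAddCommGroup W] [NormedSpace ℂ W] [OperatorSpace W]

theorem isCompletelyCompactMap_of_approximate_range (φ : CB W V)
    (h : ∀ ε : ℝ, 0 < ε → ∃ E : Submodule ℂ V, FiniteDimensional ℂ E ∧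
      ∀ (n : ℕ) (x : Matrix (Fin n) (Fin n) W), matNorm n x ≤ 1 →
        ∃ y : Matrix (Fin n) (Fin n) V, (∀ i j, y i j ∈ E) ∧
          matNorm n (x.map (φ : W →ₗ[ℂ] V) - y) < ε) : IsCompletelyCompactMap φ := by
  have htri : ∀ {n : ℕ} (x y z : Matrix (Fin n) (Fin n) V),
      matNorm n (x - z) ≤ matNorm n (x - y) + matNorm n (y - z) := fun x y z => by
    have := map_add_le_add (matNorm _) (x - y) (y - z)
    rwa [sub_add_sub_cancel] at this
  refine ⟨fun n x hx ε hε => ?_, ?_, fun ε hε => ?_⟩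
  · obtain ⟨y, hy, hxy⟩ := hx (ε / 2) (half_pos hε)
    obtain ⟨z, hz, hyz⟩ := hy (ε / 2) (half_pos hε)
    exact ⟨z, hz, (htri x y z).trans_lt (by linarith)⟩
  · obtain ⟨C, hC, hφ⟩ := φ.2
    refine ⟨C + 1, fun n x hx => ?_⟩
    obtain ⟨_, ⟨w, hw, rfl⟩, hxw⟩ := hx 1 one_pos
    have h1 := map_add_le_add (matNorm n) (x - w.map (φ : W →ₗ[ℂ] V)) (w.map (φ : W →ₗ[ℂ] V))
    rw [sub_add_cancel] at h1
    have h2 : C * matNorm n w ≤ C * 1 := mul_le_mul_of_nonneg_left hw hC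
    linarith [hφ n w]
  · obtain ⟨E, hE, hEy⟩ := h (ε / 2) (half_pos hε)
    refine ⟨E, hE, fun n x hx => ?_⟩
    obtain ⟨_, ⟨w, hw, rfl⟩, hxw⟩ := hx (ε / 2) (half_pos hε)
    obtain ⟨y, hy, hwy⟩ := hEy n w hw
    exact ⟨y, hy, (htri x _ y).trans_lt (by linarith)⟩

theorem matNorm_le_of_tendsto {n : ℕ} {x : ℕ → Matrix (Fin n) (Fin n) V}
    {y : Matrix (Fin n) (Fin n) V}
    (h : ∀ i j, Filter.Tendsto (fun k => x k i j) Filter.atTop (nhds (y i j))) {C : ℝ}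
    (hC : ∀ k, matNorm n (x k) ≤ C) : matNorm n y ≤ C := by
  have h1 : ∀ k, matNorm n y ≤ C + ∑ i, ∑ j, ‖(y - x k) i j‖ := fun k => by
    have h2 := map_add_le_add (matNorm n) (x k) (y - x k)
    rw [add_sub_cancel] at h2
    exact h2.trans (add_le_add (hC k) (matNorm_le_sum _))
  have h2 : Filter.Tendsto (fun k => C + ∑ i, ∑ j, ‖(y - x k) i j‖) Filter.atTop
      (nhds (C + ∑ i : Fin n, ∑ j : Fin n, (0 : ℝ))) := by
    refine tendsto_const_nhds.add (tendsto_finsetSum _ fun i _ => tendsto_finsetSum _ fun j _ => ?_)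
    have := (tendsto_const_nhds (x := y i j)).sub (h i j)
    rw [sub_self] at this
    simpa using this.norm
  simpa using ge_of_tendsto' h2 h1

end Criterion

section WeightedSum

/-- The terms of `weightedSum`. -/
def weightedTerm {V : Type u} [NormedAddCommGroup V] [NormedSpace ℂ V] (E : ℕ → Submodule ℂ V)
    (k : ℕ) : LinftySum (fun k => E k) →ₗ[ℂ] V :=
  ((1 / 2 : ℂ) ^ k) • ((E k).subtype ∘ₗ LinftySum.coord k)

theorem weightedTerm_apply {V : Type u} [NormedAddCommGroup V] [NormedSpace ℂ V]
    (E : ℕ → Submodule ℂ V) (k : ℕ) (x : LinftySum (fun k => E k)) :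
    weightedTerm E k x = ((1 / 2 : ℂ) ^ k) • (x.coord k : V) := rfl

theorem norm_half_pow (k : ℕ) : ‖((1 / 2 : ℂ) ^ k)‖ = (1 / 2 : ℝ) ^ k := by
  rw [norm_pow]; norm_num

theorem norm_weightedTerm_le {V : Type u} [NormedAddCommGroup V] [NormedSpace ℂ V]
    (E : ℕ → Submodule ℂ V) (k : ℕ) (x : LinftySum (fun k => E k)) :
    ‖weightedTerm E k x‖ ≤ (1 / 2 : ℝ) ^ k * ‖x‖ := by
  rw [weightedTerm_apply, norm_smul, norm_half_pow]
  gcongr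
  exact LinftySum.norm_coord_le x k

theorem summable_weightedTerm {V : Type u} [NormedAddCommGroup V] [NormedSpace ℂ V]
    [CompleteSpace V] (E : ℕ → Submodule ℂ V) (x : LinftySum (fun k => E k)) :
    Summable fun k => weightedTerm E k x :=
  Summable.of_norm_bounded ((summable_geometric_of_lt_one (by norm_num) (by norm_num)).mul_right _)
    fun k => norm_weightedTerm_le E k x

/-- The map `x ↦ ∑ 2⁻ᵏ x_k` on the `ℓ^∞` sum of a sequence of subspaces. -/
def weightedSum {V : Type u} [NormedAddCommGroup V] [NormedSpace ℂ V]
    [CompleteSpace V] (E : ℕ → Submodule ℂ V) :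
    LinftySum (fun k => E k) →ₗ[ℂ] V where
  toFun x := ∑' k, weightedTerm E k x
  map_add' x y := by
    simp only [map_add]
    exact (summable_weightedTerm E x).tsum_add (summable_weightedTerm E y)
  map_smul' c x := by
    simp only [map_smul]
    exact (summable_weightedTerm E x).tsum_const_smul c

theorem hasSum_weightedSum {V : Type u} [NormedAddCommGroup V] [NormedSpace ℂ V]
    [CompleteSpace V] (E : ℕ → Submodule ℂ V)
    (x : LinftySum (fun k => E k)) :
    HasSum (fun k => weightedTerm E k x) (weightedSum E x) := (summable_weightedTerm E x).hasSum

theorem weightedSum_incl {V : Type u} [NormedAddCommGroup V] [NormedSpace ℂ V]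
    [CompleteSpace V] (E : ℕ → Submodule ℂ V) (k : ℕ) (x : E k) :
    weightedSum E (LinftySum.incl k x) = ((1 / 2 : ℂ) ^ k) • (x : V) := by
  have h := hasSum_single (f := fun l => weightedTerm E l
    (LinftySum.incl (E := fun k => E k) k x)) k fun l hl => by
      rw [weightedTerm_apply, LinftySum.coord_incl_ne hl]; simp
  rw [(hasSum_weightedSum E _).unique h, weightedTerm_apply, LinftySum.coord_incl_self]

variable {V : Type u} [NormedAddCommGroup V] [NormedSpace ℂ V] [OperatorSpace V]

variable (E : ℕ → Submodule ℂ V)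

theorem matNorm_weightedTerm_le (k : ℕ) {n : ℕ}
    (x : Matrix (Fin n) (Fin n) (LinftySum (fun k => E k))) :
    matNorm n (x.map (weightedTerm E k)) ≤ (1 / 2 : ℝ) ^ k * matNorm n x := by
  have e : x.map (weightedTerm E k)
      = ((1 / 2 : ℂ) ^ k) • (x.map (LinftySum.coord k)).map (E k).subtype := rfl
  rw [e, map_smul_eq_mul, norm_half_pow, ← matNorm_submodule]
  gcongr
  exact LinftySum.le_seminorm x k

variable [CompleteSpace V]

theorem sum_half_pow_le (m : ℕ) : ∑ k ∈ Finset.range m, (1 / 2 : ℝ) ^ k ≤ 2 := by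
  have h := Summable.sum_le_tsum (Finset.range m) (fun k _ => by positivity)
    (summable_geometric_of_lt_one (r := (1 / 2 : ℝ)) (by norm_num) (by norm_num))
  rwa [tsum_geometric_two] at h

/-- The constant is the geometric tail 2⁻ᴺ + 2⁻ᴺ⁻¹ + ⋯. For `N = 0` the estimate is complete
boundedness; as `N` grows it gives complete compactness. -/
theorem matNorm_weightedSum_sub_le (N : ℕ) {n : ℕ}
    (x : Matrix (Fin n) (Fin n) (LinftySum (fun k => E k))) :
    matNorm n (x.map (weightedSum E) - ∑ k ∈ Finset.range N, x.map (weightedTerm E k))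
      ≤ 2 * (1 / 2 : ℝ) ^ N * matNorm n x := by
  refine matNorm_le_of_tendsto
    (x := fun m => ∑ k ∈ Finset.range m, x.map (weightedTerm E (k + N))) (fun i j => ?_) fun m => ?_
  · have h := ((hasSum_nat_add_iff' N).2 (hasSum_weightedSum E (x i j))).tendsto_sum_nat
    simpa [Matrix.sum_apply] using h
  · have h1 : matNorm n (∑ k ∈ Finset.range m, x.map (weightedTerm E (k + N)))
        ≤ ∑ k ∈ Finset.range m, matNorm n (x.map (weightedTerm E (k + N))) :=
      Finset.le_sum_of_subadditive _ (map_zero _).le (map_add_le_add _) _ _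
    refine h1.trans ((Finset.sum_le_sum fun k _ => matNorm_weightedTerm_le E (k + N) x).trans ?_)
    rw [← Finset.sum_mul]
    simp only [pow_add]
    rw [← Finset.sum_mul]
    gcongr
    exact sum_half_pow_le m

theorem CBBound_weightedSum : CBBound (weightedSum E) 2 := fun n x => by
  simpa using matNorm_weightedSum_sub_le E 0 x

/-- The kernel of `weightedSum`. -/
abbrev weightedKer : Submodule ℂ (LinftySum (fun k => E k)) := LinearMap.ker (weightedSum E)

instance isClosed_weightedKer : IsClosed (weightedKer E : Set (LinftySum (fun k => E k))) :=
  ContinuousLinearMap.isClosed_ker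
    (cbToContinuous (⟨weightedSum E, 2, zero_le_two, CBBound_weightedSum E⟩ :
      CB (LinftySum (fun k => E k)) V))

/-- The injective map induced by `weightedSum`. -/
def weightedQuot : CB (LinftySum (fun k => E k) ⧸ weightedKer E) V :=
  ⟨(weightedKer E).liftQ (weightedSum E) le_rfl, 2, zero_le_two,
    CBBound_liftQ _ _ le_rfl zero_le_two (CBBound_weightedSum E)⟩

theorem weightedQuot_injective : Function.Injective
    (weightedQuot E : (LinftySum (fun k => E k) ⧸ weightedKer E) →ₗ[ℂ] V) :=
  LinearMap.ker_eq_bot.1 (Submodule.ker_liftQ_eq_bot _ _ _ le_rfl)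

theorem isCompletelyCompactMap_weightedQuot [∀ k, FiniteDimensional ℂ (E k)] :
    IsCompletelyCompactMap (weightedQuot E) := by
  refine isCompletelyCompactMap_of_approximate_range _ fun ε hε => ?_
  -- The quotient infimum need not be attained, so lifts of the unit ball have norm at most 2. With
  -- the factor 2 of the tail this accounts for ε / 4.
  obtain ⟨N, hN⟩ := exists_pow_lt_of_lt_one (show 0 < ε / 4 by positivity)
    (show (1 / 2 : ℝ) < 1 by norm_num)
  refine ⟨(Finset.range N).sup E, inferInstance, fun n y hy => ?_⟩
  obtain ⟨x, rfl, hx⟩ := exists_lift_matNorm_lt y one_pos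
  refine ⟨∑ k ∈ Finset.range N, x.map (weightedTerm E k), fun i j => ?_, ?_⟩
  · rw [Matrix.sum_apply]
    refine Submodule.sum_mem _ fun k hk => Submodule.smul_mem _ _ ?_
    exact Finset.le_sup (f := E) hk (SetLike.coe_mem ((x i j).coord k))
  · refine (matNorm_weightedSum_sub_le E N x).trans_lt ?_
    change quotientMatNorm (weightedKer E) n _ ≤ 1 at hy
    have h2 : matNorm n x ≤ 2 := by linarith
    have h3 : 0 < (1 / 2 : ℝ) ^ N := by positivity
    nlinarith [mul_le_mul_of_nonneg_left h2 h3.le]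

end WeightedSum

/-! ### Factoring tensors through an injective completely compact map -/

section Factorization

theorem exists_tensor_over_submodule {V : Type u} [AddCommGroup V] [Module ℂ V] {ι : Type}
    [Fintype ι] {Y : ι → Type v}
    [∀ i, AddCommGroup (Y i)] [∀ i, Module ℂ (Y i)] (u : ∀ i, V ⊗[ℂ] Y i) :
    ∃ E : Submodule ℂ V, FiniteDimensional ℂ E ∧
      ∀ i, ∃ t : E ⊗[ℂ] Y i, E.subtype.rTensor (Y i) t = u i := by
  choose F hF hFu using fun i => TensorProduct.exists_finite_submodule_left_of_setFinite {u i}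
    (Set.finite_singleton _)
  refine ⟨Finset.univ.sup F, inferInstance, fun i => ?_⟩
  obtain ⟨t, ht⟩ := hFu i (Set.mem_singleton _)
  have hle : F i ≤ Finset.univ.sup F := Finset.le_sup (Finset.mem_univ i)
  refine ⟨(Submodule.inclusion hle).rTensor (Y i) t, ?_⟩
  rw [← LinearMap.rTensor_comp_apply, Submodule.subtype_comp_inclusion, ht]

variable {V : Type u} [NormedAddCommGroup V] [NormedSpace ℂ V] [OperatorSpace V]

/-- The minimal tensor norm is injective. -/
theorem minSeminorm_submodule (E : Submodule ℂ V) (Y : Type v) [NormedAddCommGroup Y]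
    [NormedSpace ℂ Y] [OperatorSpace Y] (u : E ⊗[ℂ] Y) :
    minSeminorm E Y u = minSeminorm V Y (E.subtype.rTensor Y u) := by
  rw [minSeminorm_apply, minSeminorm_apply]
  congr 1
  ext s
  rw [CCToMat.slice_rTensor, matNorm_submodule]

theorem exists_controlled_series {Y : Type v} [NormedAddCommGroup Y] [NormedSpace ℂ Y]
    [OperatorSpace Y] (a : CompletedMinTensor V Y) :
    ∃ u : ℕ → MinTensor V Y,
      Filter.Tendsto (fun n => ∑ k ∈ Finset.range (n + 1), (u k : CompletedMinTensor V Y))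
        Filter.atTop (nhds a) ∧ ∀ k, 0 < k → ‖u k‖ < (1 / 4 : ℝ) ^ k := by
  obtain ⟨u, h1, -, h2⟩ := controlled_sum_of_mem_closure_range
    (j := (UniformSpace.Completion.toCompl : MinTensor V Y →+ CompletedMinTensor V Y))
    (b := a) (UniformSpace.Completion.denseRange_coe a) (f := fun k => (1 / 4 : ℝ) ^ k)
    (fun k => by positivity)
  exact ⟨u, h1, fun k hk => by simpa using h2 k hk⟩

variable [CompleteSpace V]

/-- The decay 4⁻ᵏ is split in two: one factor 2⁻ᵏ is the weight built into the map, the other keeps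
the lifted series summable. The spaces `E k` serve all indices `i` at once, so all tensors factor
through the same map. -/
theorem exists_injective_factorization {ι : Type} [Fintype ι] {Y : ι → Type u}
    [∀ i, NormedAddCommGroup (Y i)] [∀ i, NormedSpace ℂ (Y i)] [∀ i, OperatorSpace (Y i)]
    (a : ∀ i, CompletedMinTensor V (Y i)) :
    ∃ E : ℕ → Submodule ℂ V, (∀ k, FiniteDimensional ℂ (E k)) ∧
      ∃ b : ∀ i, CompletedMinTensor (LinftySum (fun k => E k) ⧸ weightedKer E) (Y i),
        ∀ i, tensorId (Y i) (weightedQuot E) (b i) = a i := by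
  choose u hua hu using fun i => exists_controlled_series (a i)
  choose E hE t ht using fun k => exists_tensor_over_submodule (V := V) (Y := Y) (fun i => u i k)
  let X := LinftySum (fun k => E k)
  let q : CB X (X ⧸ weightedKer E) :=
    ⟨(weightedKer E).mkQ, 1, zero_le_one, CBBound_mkQ (weightedKer E)⟩
  -- The factor 2ᵏ cancels the weight of the k-th summand, so the weighted sum sends `z i k` back to
  -- `u i k`. Injectivity of the minimal norm keeps the norm of `t k i` equal to that of `u i k`.
  let z : ∀ i, ℕ → MinTensor X (Y i) := fun i k =>
    ((2 : ℂ) ^ k • (LinftySum.incl (E := fun k => E k) k).rTensor (Y i) (t k i) : X ⊗[ℂ] Y i)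
  have hz : ∀ i k, ‖z i k‖ ≤ 2 ^ k * ‖u i k‖ := fun i k => by
    change minSeminorm X (Y i) (z i k) ≤ 2 ^ k * minSeminorm V (Y i) (u i k)
    refine (map_smul_eq_mul _ _ _).le.trans ?_
    rw [norm_pow, Complex.norm_ofNat, ← ht k i, ← minSeminorm_submodule]
    gcongr
    exact (minSeminorm_map_le (Y i) _ zero_le_one (LinftySum.CBBound_incl k) _).trans
      (one_mul _).le
  have hsum : ∀ i, Summable fun k => (z i k : CompletedMinTensor X (Y i)) := fun i => by
    -- The initial term of the series has no norm bound, hence the shift by one.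
    refine (summable_nat_add_iff 1).1 (Summable.of_norm_bounded
      (g := fun k => (1 / 2 : ℝ) ^ (k + 1))
      ((summable_nat_add_iff 1).2 (summable_geometric_of_lt_one (by norm_num) (by norm_num)))
      fun k => ?_)
    rw [UniformSpace.Completion.norm_coe]
    refine (hz i (k + 1)).trans ?_
    calc (2 : ℝ) ^ (k + 1) * ‖u i (k + 1)‖ ≤ 2 ^ (k + 1) * (1 / 4) ^ (k + 1) := by
          gcongr; exact (hu i (k + 1) k.succ_pos).le
      _ = (1 / 2) ^ (k + 1) := by rw [← mul_pow]; norm_num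
  refine ⟨E, hE, fun i => tensorId (Y i) q (∑' k, (z i k : CompletedMinTensor X (Y i))),
    fun i => ?_⟩
  rw [← tensorId_cbComp]
  have h1 := ((hsum i).hasSum.mapL (tensorId (Y i) (cbComp (weightedQuot E) q))).tendsto_sum_nat
  have h2 : ∀ k, tensorId (Y i) (cbComp (weightedQuot E) q) (z i k : CompletedMinTensor X (Y i))
      = (u i k : CompletedMinTensor V (Y i)) := fun k => by
    rw [tensorId_coe]
    congr 1
    change (weightedSum E).rTensor (Y i) ((2 : ℂ) ^ k •
      (LinftySum.incl (E := fun k => E k) k).rTensor (Y i) (t k i)) = u i k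
    have e : weightedSum E ∘ₗ LinftySum.incl (E := fun k => E k) k
        = ((1 / 2 : ℂ) ^ k) • (E k).subtype := LinearMap.ext fun x => weightedSum_incl E k x
    rw [map_smul, ← LinearMap.rTensor_comp_apply, e, LinearMap.rTensor_smul, LinearMap.smul_apply,
      smul_smul, ← mul_pow, show (2 * (1 / 2) : ℂ) = 1 by norm_num, one_pow, one_smul, ht]
  simp only [h2] at h1
  exact tendsto_nhds_unique (h1.comp (Filter.tendsto_add_atTop_nat 1)) (hua i)

end Factorization

/-! ### From completely compact maps back to the approximation property -/

section Converse

variable {V : Type u} [NormedAddCommGroup V] [NormedSpace ℂ V] [OperatorSpace V]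

variable (V) in
/-- An element of the tensor product of `V` with the operators on some Hilbert space. -/
structure OperatorTensor where
  H : Type u
  [normed : NormedAddCommGroup H]
  [inner : InnerProductSpace ℂ H]
  [complete : CompleteSpace H]
  a : CompletedMinTensor V (H →L[ℂ] H)

attribute [instance] OperatorTensor.normed OperatorTensor.inner OperatorTensor.complete

/-- Bundling the Hilbert space with the tensor turns the nested infimum into one over a single index
type, where basic neighbourhoods are finite intersections. -/
theorem stronglyStablePointNormTopology_eq : stronglyStablePointNormTopology V V
    = ⨅ t : OperatorTensor V, TopologicalSpace.induced
      (fun φ : CB V V => tensorId (t.H →L[ℂ] t.H) φ t.a) inferInstance := by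
  unfold stronglyStablePointNormTopology
  refine le_antisymm (le_iInf fun t => ?_) ?_
  · exact iInf_le_of_le t.H (iInf_le_of_le t.normed (iInf_le_of_le t.inner
      (iInf_le_of_le t.complete (iInf_le _ t.a))))
  · exact le_iInf fun H => le_iInf fun _ => le_iInf fun _ => le_iInf fun _ => le_iInf fun a =>
      iInf_le _ (⟨H, a⟩ : OperatorTensor V)

/-- Neighbourhoods for the strongly stable point-norm topology involve finitely many evaluations. -/
theorem mem_closure_stronglyStable {S : Set (CB V V)} {φ : CB V V}
    (h : ∀ (n : ℕ) (t : Fin n → OperatorTensor V),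
      (fun i => tensorId ((t i).H →L[ℂ] (t i).H) φ (t i).a) ∈
        closure ((fun ψ i => tensorId ((t i).H →L[ℂ] (t i).H) ψ (t i).a) '' S)) :
    φ ∈ @closure (CB V V) (stronglyStablePointNormTopology V V) S := by
  let _ := stronglyStablePointNormTopology V V
  rw [mem_closure_iff_nhds]
  intro U hU
  change U ∈ @nhds (CB V V) (stronglyStablePointNormTopology V V) φ at hU
  rw [stronglyStablePointNormTopology_eq, nhds_iInf] at hU
  simp only [nhds_induced] at hU
  obtain ⟨I, hI, O, hO, rfl⟩ := Filter.mem_iInf.1 hU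
  have := hI.fintype
  let e := Fintype.equivFin I
  choose N hN hNO using fun i => Filter.mem_comap.1 (hO i)
  obtain ⟨_, hz, ψ, hψ, rfl⟩ := mem_closure_iff_nhds.1 (h _ fun k => (e.symm k).1) _
    (set_pi_mem_nhds Set.finite_univ fun k _ => hN (e.symm k))
  have hmem : ∀ k, tensorId ((e.symm k).1.H →L[ℂ] (e.symm k).1.H) ψ (e.symm k).1.a ∈
      N (e.symm k) := fun k => hz k (Set.mem_univ _)
  refine ⟨ψ, Set.mem_iInter.2 fun i => hNO i ?_, hψ⟩
  obtain ⟨k, rfl⟩ := e.symm.surjective i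
  exact hmem k

/-- A neighbourhood of the identity tests finitely many tensors simultaneously. They are factored
through one injective map, so that a single finite rank map on `V` approximates all of them. -/
theorem hasStrongOperatorApproximationProperty_of_approximation [CompleteSpace V]
    (h : ∀ (W : Type u) [NormedAddCommGroup W] [NormedSpace ℂ W] [CompleteSpace W]
      [OperatorSpace W] (φ : CB W V), IsCompletelyCompactMap φ →
      ∀ ε : ℝ, 0 < ε → ∃ ψ : CB W V, IsFiniteRank ψ ∧ cbNorm (φ - ψ) < ε) :
    HasStrongOperatorApproximationProperty V := by
  refine mem_closure_stronglyStable fun n t => ?_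
  obtain ⟨E, hE, b, hb⟩ := exists_injective_factorization (fun i => (t i).a)
  have h1 := mem_closure_of_injective_factorization (weightedQuot E) (weightedQuot_injective E) b
    (h _ _ (isCompletelyCompactMap_weightedQuot E))
  simp only [hb] at h1
  simp only [tensorId_id]
  refine closure_mono ?_ h1
  rintro _ ⟨φ, hφ, rfl⟩
  exact ⟨φ, hφ, rfl⟩

end Converse

end

theorem mainTheorem2 (V : Type u) [NormedAddCommGroup V] [NormedSpace ℂ V] [CompleteSpace V]
    [OperatorSpace V] :
    HasStrongOperatorApproximationProperty V ↔
      ∀ (W : Type u) [NormedAddCommGroup W] [NormedSpace ℂ W] [CompleteSpace W] [OperatorSpace W]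
        (φ : CB W V), IsCompletelyCompactMap φ →
        ∀ ε : ℝ, 0 < ε → ∃ ψ : CB W V, IsFiniteRank ψ ∧ cbNorm (φ - ψ) < ε := by
  refine ⟨fun h W _ _ _ _ φ hφ ε hε => h.approximation φ hφ hε, fun h => ?_⟩
  exact hasStrongOperatorApproximationProperty_of_approximation fun W _ _ _ _ φ => h W φ
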